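/- Let $G$ be a connected complex reductive Lie group, that is, a connected complex Lie group which has a faithful finite-dimensional holomorphic representation and is the complexification of a compact subgroup $U$, meaning $\mathrm{Lie}(G)=\mathrm{Lie}(U)+i\,\mathrm{Lie}(U)$. Write $C(\cdot)$ for the center of a group and $C(G)_0$ for the identity component of $C(G)$. (1) If $K$ is a maximal compact subgroup of $G$, then its normalizer satisfies $$N_G(K)=C(G)\cdot K=C(G)_0\cdot K .$$ (2) Let $K_1,K_2$ be two maximal compact subgroups of $G$, and assume that there is a compact subgroup $K\subseteq K_1\cap K_2$ which contains a maximal compact torus $T$ of $G$ (a compact connected abelian subgroup of $G$, maximal among such subgroups). Then there is $t\in C(K_{\mathbb C})$ with $$K_2=t\,K_1\,t^{-1},$$ where $K_{\mathbb C}\subseteq G$ is the complexification of $K$, the subgroup of $G$ generated by $K$ and by all $\exp(zX)$ with $X\in\mathrm{Lie}(K)$ and $z\in\mathbb C$. -/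

import Mathlib

open scoped Manifold ContDiff Pointwise

namespace ComplexLie

variable (E : Type*) [NormedAddCommGroup E] [NormedSpace ℂ E]
variable {G : Type*} [TopologicalSpace G] [ChartedSpace E G] [Group G]

/-- `φ` is the holomorphic one-parameter subgroup `z ↦ exp (z X)` of the complex Lie group `G`:
a holomorphic homomorphism `(ℂ, +) → G` with velocity `X` at `0`. The Lie algebra `T₁ G` is
identified with the model space `E` by the preferred chart at `1`, as in Mathlib's
`TangentSpace` and `GroupLieAlgebra`. -/
structure IsOneParam (φ : ℂ → G) (X : E) : Prop where
  holomorphic : ContMDiff 𝓘(ℂ, ℂ) 𝓘(ℂ, E) ω φ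
  map_add : ∀ z w : ℂ, φ (z + w) = φ z * φ w
  velocity : HasDerivAt (fun z : ℂ => extChartAt 𝓘(ℂ, E) (1 : G) (φ z)) X 0

/-- The (real) Lie algebra `{X | exp (t X) ∈ H for all real t}` of a closed subgroup `H` of the
complex Lie group `G`. -/
def lieAlgebraOf (H : Subgroup G) : Set E :=
  {X | ∃ φ : ℂ → G, IsOneParam E φ X ∧ ∀ t : ℝ, φ (t : ℂ) ∈ H}

/-- The complexification `K_ℂ` inside `G` of a compact subgroup `K` with Lie algebra `𝔨`: the
subgroup generated by `K` and by all `exp (z X)` with `X ∈ 𝔨` and `z ∈ ℂ`, that is, by `K` and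
`exp (i 𝔨)`. -/
def complexification (K : Subgroup G) : Subgroup G :=
  Subgroup.closure ((K : Set G) ∪
    {g | ∃ (φ : ℂ → G) (X : E) (z : ℂ),
      IsOneParam E φ X ∧ (∀ t : ℝ, φ (t : ℂ) ∈ K) ∧ φ z = g})

variable (G) in
/-- A connected complex Lie group `G` is *reductive* if it is linear, i.e. has a faithful
finite-dimensional holomorphic representation, and is the complexification of a compact
subgroup `U`, i.e. `𝔤 = 𝔲 + i 𝔲`. (Used only for connected `G`.) -/
structure IsReductive : Prop where
  linear : ∃ (n : ℕ) (ρ : G →* GL (Fin n) ℂ), Function.Injective ρ ∧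
    ∀ i j, ContMDiff 𝓘(ℂ, E) 𝓘(ℂ, ℂ) ω (fun g : G => (ρ g : Matrix (Fin n) (Fin n) ℂ) i j)
  compact_form : ∃ U : Subgroup G, IsCompact (U : Set G) ∧
    Submodule.span ℂ (lieAlgebraOf E U) = ⊤

end ComplexLie

section Compact

variable {G : Type*} [TopologicalSpace G] [Group G]

/-- `K` is a maximal compact subgroup of `G`. -/
def IsMaximalCompact (K : Subgroup G) : Prop :=
  Maximal (fun H : Subgroup G => IsCompact (H : Set G)) K

/-- A compact torus in a Lie group: a compact connected abelian subgroup. -/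
structure IsCompactTorus (T : Subgroup G) : Prop where
  compact : IsCompact (T : Set G)
  connected : IsConnected (T : Set G)
  comm : ∀ x ∈ T, ∀ y ∈ T, x * y = y * x

/-- `T` is a maximal compact torus of `G`. -/
def IsMaximalCompactTorus (T : Subgroup G) : Prop :=
  Maximal (fun S : Subgroup G => IsCompactTorus S) T

variable (G) in
/-- The identity component `C(G)₀` of the center of `G`. -/
def centerIdentityComponent : Set G :=
  connectedComponentIn (Subgroup.center G : Set G) 1

end Compact

section MatrixAnalysis

open scoped Matrix.Norms.L2Operator ComplexOrder MatrixOrder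
open MeasureTheory NormedSpace Matrix Topology

/-! ### Haar measure on compact groups -/

/-! The core is a polar decomposition. Averaging an inner product over the compact form `U` makes a
faithful representation `ρ` unitary on `U`. The aim is then `G = U exp 𝔭`, with `exp 𝔭` the positive
definite part of `ρ(G)`, stable under the powers `exp (z Y)`. Instead of a Zariski closure, the
proof uses the holomorphic functions `J_N(g, g⁻¹) = ∫ (tr (g u) + tr (u⁻¹ g⁻¹) + 2n)^N du`, which
are right invariant under `U` and separate `U` from the other unitary matrices. Their right
stabilizer `Γ` is closed, contains `ρ(G)`, and meets the unitary group in `ρ(U)`. If `exp Y ∈ Γ`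
with `Y` Hermitian, then `J_N(exp (z Y), exp (-z Y))` has period 1 and is bounded on the strip `|Re
z| ≤ 1`, hence is constant by Liouville. Separation gives `exp (i s Y) ∈ ρ(U)`, and holomorphic
extension gives `exp (z Y) ∈ ρ(G)` (`exists_closed_subgroup_unitary`, `isPolarRep_of_unitary`).

Next comes Cartan's fixed point theorem (`IsPolarRep.exists_conj_mem`). For a compact subgroup `L`
with invariant form `q`, the energy `tr (q p⁻¹) + tr (q⁻¹ p)` is proper, strictly convex along
geodesics and `L`-invariant on the positive part of `ρ(G)`. Its unique minimum is fixed by `L`, so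
its square root conjugates `L` into `U`. Hence all maximal compact subgroups are conjugates of `U`,
and each is the unitary part of a polar representation.

Both claims then rest on one rigidity fact: if `k` and `exp Y k exp (-Y)` are unitary with `Y`
Hermitian, then `Y` commutes with `k`. For (1), the positive factor of an element of `N_G(K)`
commutes with `K`, hence is central, and `exp (z Y)` joins it to `1` inside the center. For (2), `K₂
= exp (-Y) K₁ exp Y` with `Y` Hermitian, and `Y` commutes with `K ⊇ T`. The group `exp (i t Y) ⊆ K₁`
commutes with `T`, so maximality of the torus puts it in `T ⊆ K`; thus `exp (-Y)` lies in `K_ℂ` and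
is central there. -/

theorem exists_invariant_probability (U : Type*) [Group U] [TopologicalSpace U]
    [IsTopologicalGroup U] [CompactSpace U] :
    ∃ (_ : MeasurableSpace U) (_ : BorelSpace U) (μ : Measure U),
      IsProbabilityMeasure μ ∧ μ.IsMulLeftInvariant ∧ μ.IsOpenPosMeasure := by
  let _ : MeasurableSpace U := borel U
  have : BorelSpace U := ⟨rfl⟩
  refine ⟨inferInstance, inferInstance, Measure.haarMeasure ⊤, ⟨?_⟩, inferInstance, inferInstance⟩
  have := Measure.haarMeasure_self (G := U) (K₀ := ⊤)
  simpa using this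

/-- Two nonnegative continuous functions with the same moments have comparable maxima. -/
theorem not_forall_lt_of_moments_eq {U : Type*} [TopologicalSpace U] [CompactSpace U]
    [MeasurableSpace U] [BorelSpace U] (μ : Measure U) [IsProbabilityMeasure μ]
    [μ.IsOpenPosMeasure] {φ ψ : U → ℝ} (hφ : Continuous φ) (hψ : Continuous ψ)
    (hφ0 : ∀ u, 0 ≤ φ u) (hψ0 : ∀ u, 0 ≤ ψ u)
    (h : ∀ N : ℕ, ∫ u, φ u ^ N ∂μ = ∫ u, ψ u ^ N ∂μ) (u₀ : U) : ¬ ∀ u, ψ u < φ u₀ := by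
  intro hlt
  have : Nonempty U := ⟨u₀⟩
  obtain ⟨v, hv⟩ := (isCompact_univ (X := U)).exists_isMaxOn ⟨u₀, trivial⟩ hψ.continuousOn
  obtain ⟨m, hm1, hm2⟩ := exists_between (hlt v)
  have hm0 : 0 < m := (hψ0 v).trans_lt hm1
  have hO : IsOpen {u | m < φ u} := isOpen_lt continuous_const hφ
  have hc : 0 < μ.real {u | m < φ u} :=
    ENNReal.toReal_pos (hO.measure_pos μ ⟨u₀, hm2⟩).ne' (measure_ne_top _ _)
  have hint : ∀ (f : U → ℝ), Continuous f → Integrable f μ := fun f hf =>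
    hf.integrable_of_hasCompactSupport (HasCompactSupport.of_compactSpace f)
  -- Markov's inequality for `φ ^ N`: the set where `φ` exceeds `m` has fixed positive measure, yet
  -- this bound tends to `0` because `max ψ < m`.
  have key : ∀ N : ℕ, μ.real {u | m < φ u} ≤ (ψ v / m) ^ N := by
    intro N
    have h1 := mul_meas_ge_le_integral_of_nonneg (μ := μ) (f := fun u => φ u ^ N)
      (.of_forall fun u => pow_nonneg (hφ0 u) N) (hint _ (hφ.pow N)) (m ^ N)
    have h2 : μ.real {u | m < φ u} ≤ μ.real {u | m ^ N ≤ φ u ^ N} :=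
      measureReal_mono (fun u hu => pow_le_pow_left₀ hm0.le (le_of_lt hu) N)
    have h3 : ∫ u, ψ u ^ N ∂μ ≤ ψ v ^ N := by
      have := integral_mono (μ := μ) (hint _ (hψ.pow N)) (integrable_const (ψ v ^ N))
        (fun u => pow_le_pow_left₀ (hψ0 u) (hv.2 (Set.mem_univ u)) N)
      simpa using this
    rw [div_pow, le_div_iff₀ (pow_pos hm0 N), mul_comm]
    calc m ^ N * μ.real {u | m < φ u} ≤ m ^ N * μ.real {u | m ^ N ≤ φ u ^ N} := by gcongr
      _ ≤ _ := h1
      _ = _ := h N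
      _ ≤ _ := h3
  have hr : ψ v / m < 1 := (div_lt_one hm0).2 hm1
  have ht := tendsto_pow_atTop_nhds_zero_of_lt_one (div_nonneg (hψ0 v) hm0.le) hr
  exact absurd (ge_of_tendsto' ht key) (not_le.2 hc)

/-! ### Traces of unitary matrices -/

variable {n : ℕ}

local notation "Mat" => Matrix (Fin n) (Fin n) ℂ

theorem Matrix.trace_one_sub_conjTranspose_mul {V : Mat} (hV : V ∈ unitaryGroup (Fin n) ℂ) :
    ((1 - V)ᴴ * (1 - V)).trace = ((2 * n - 2 * V.trace.re : ℝ) : ℂ) := by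
  have h1 : Vᴴ * V = 1 := mem_unitaryGroup_iff'.1 hV
  have h2 : (1 - V)ᴴ * (1 - V) = 1 + 1 - V - Vᴴ := by
    rw [conjTranspose_sub, conjTranspose_one, sub_mul, mul_sub, mul_sub, h1]; simp; abel
  rw [h2]
  simp only [trace_sub, trace_add, trace_one, trace_conjTranspose, Fintype.card_fin]
  apply Complex.ext <;> simp; ring

theorem Matrix.trace_re_le_of_mem_unitaryGroup {V : Mat} (hV : V ∈ unitaryGroup (Fin n) ℂ) :
    V.trace.re ≤ n := by
  have h := (posSemidef_conjTranspose_mul_self (1 - V)).trace_nonneg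
  rw [trace_one_sub_conjTranspose_mul hV, Complex.zero_le_real] at h
  linarith

theorem Matrix.neg_le_trace_re_of_mem_unitaryGroup {V : Mat} (hV : V ∈ unitaryGroup (Fin n) ℂ) :
    -(n : ℝ) ≤ V.trace.re := by
  have : -V ∈ unitaryGroup (Fin n) ℂ := by
    rw [mem_unitaryGroup_iff'] at hV ⊢; simpa using hV
  have h := trace_re_le_of_mem_unitaryGroup this
  rw [trace_neg, Complex.neg_re] at h
  linarith

/-- The squared Hilbert–Schmidt distance from `V` to `1` is `2n - 2 Re tr V`, so among unitary
matrices the real trace attains its maximum only at `1`. -/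
theorem Matrix.eq_one_of_trace_re_eq {V : Mat} (hV : V ∈ unitaryGroup (Fin n) ℂ)
    (h : V.trace.re = n) : V = 1 := by
  have h1 := trace_one_sub_conjTranspose_mul hV
  rw [h, sub_self, Complex.ofReal_zero, trace_conjTranspose_mul_self_eq_zero_iff] at h1
  exact (sub_eq_zero.1 h1).symm

/-! ### Holomorphic functions that separate a compact group from its complement -/

/-- For a compact group of unitary matrices there are holomorphic functions of `(g, g⁻¹)`, right
invariant under the group, that tell its elements from all other unitary matrices. -/
theorem exists_separating_holomorphic {U : Type*} [Group U] [TopologicalSpace U]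
    [IsTopologicalGroup U] [CompactSpace U] (R : U →* Mat) (hR : Continuous R)
    (hRu : ∀ u, R u ∈ unitaryGroup (Fin n) ℂ) :
    ∃ J : ℕ → Mat × Mat → ℂ, (∀ N, Differentiable ℂ (J N)) ∧
      (∀ N u a b, J N (a * R u, (R u)ᴴ * b) = J N (a, b)) ∧
      ∀ w ∈ unitaryGroup (Fin n) ℂ, (∀ N, J N (w, wᴴ) = J N (1, 1)) → ∃ u, R u = w := by
  obtain ⟨m, hm, μ, hμ1, hμ2, hμ3⟩ := exists_invariant_probability U
  have hcont : ∀ p : Mat × Mat,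
      Continuous (fun u : U => (p.1 * R u).trace + ((R u)ᴴ * p.2).trace) := by
    intro p
    exact ((continuous_const.matrix_mul hR).matrix_trace).add
      ((hR.matrix_conjTranspose.matrix_mul continuous_const).matrix_trace)
  let c : Mat × Mat →ₗ[ℂ] C(U, ℂ) :=
    { toFun := fun p => ⟨_, hcont p⟩
      map_add' := fun p q => by
        ext u; simp [add_mul, mul_add, trace_add]; ring
      map_smul' := fun r p => by
        ext u; simp [trace_smul]; ring }
  let I : C(U, ℂ) →ₗ[ℂ] ℂ :=
    { toFun := fun f => ∫ u, f u ∂μ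
      map_add' := fun f g => by
        have hi : ∀ f : C(U, ℂ), Integrable f μ := fun f =>
          f.continuous.integrable_of_hasCompactSupport (HasCompactSupport.of_compactSpace _)
        exact integral_add (hi f) (hi g)
      map_smul' := fun r f => integral_const_mul r _ }
  let I' : C(U, ℂ) →L[ℂ] ℂ := I.mkContinuous 1 (fun f => by
    have := norm_integral_le_of_norm_le_const (μ := μ) (.of_forall fun u => f.norm_coe_le_norm u)
    simpa [I] using this)
  -- A linear map, a power and a bounded functional compose to a holomorphic function, with no
  -- differentiation under the integral. The shift `2n` makes the base nonnegative at pairs `(w,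
  -- wᴴ)` with `w` unitary.
  let J : ℕ → Mat × Mat → ℂ := fun N p => I' ((c p + ContinuousMap.const U (2 * n : ℂ)) ^ N)
  have hJ : ∀ N p, J N p =
      ∫ u, ((p.1 * R u).trace + ((R u)ᴴ * p.2).trace + 2 * n) ^ N ∂μ := fun N p => rfl
  refine ⟨J, fun N => ?_, fun N u a b => ?_, fun w hw h => ?_⟩
  · have hc : Differentiable ℂ c := (LinearMap.toContinuousLinearMap c).differentiable
    exact I'.differentiable.comp ((hc.add_const _).pow N)
  · rw [hJ, hJ]
    rw [← integral_mul_left_eq_self (fun v => ((((a, b) : Mat × Mat).1 * R v).trace +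
      ((R v)ᴴ * ((a, b) : Mat × Mat).2).trace + 2 * (n : ℂ)) ^ N) u]
    refine integral_congr_ae (.of_forall fun v => ?_)
    simp only [map_mul, conjTranspose_mul, mul_assoc]
  · by_contra hcon
    push Not at hcon
    have hwu : ∀ u, w * R u ∈ unitaryGroup (Fin n) ℂ := fun u => mul_mem hw (hRu u)
    have hreal : ∀ N v, v ∈ unitaryGroup (Fin n) ℂ →
        J N (v, vᴴ) = ((∫ u, (2 * (v * R u).trace.re + 2 * n) ^ N ∂μ : ℝ) : ℂ) := by
      intro N v hv
      rw [hJ]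
      refine Eq.trans (integral_congr_ae (.of_forall fun u => ?_)) integral_complex_ofReal
      have : ((R u)ᴴ * vᴴ).trace = star (v * R u).trace := by
        rw [← conjTranspose_mul, trace_conjTranspose]
      simp only [this]
      push_cast
      congr 2
      apply Complex.ext <;> simp; ring
    have hct : ∀ v : Mat, Continuous fun u => 2 * (v * R u).trace.re + 2 * (n : ℝ) := fun v =>
      ((Complex.continuous_re.comp
        (continuous_const.matrix_mul hR).matrix_trace).const_mul 2 |>.add continuous_const)
    -- At `w = 1` the base takes the value `4n` at `u = 1`; if `w` lay outside the group, its base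
    -- would stay strictly below `4n`, against the equality of all moments.
    refine not_forall_lt_of_moments_eq μ (hct 1) (hct w) (fun u => ?_) (fun u => ?_) (fun N => ?_)
      (1 : U) (fun u => ?_)
    · have := neg_le_trace_re_of_mem_unitaryGroup (mul_mem (one_mem _) (hRu u)); linarith
    · have := neg_le_trace_re_of_mem_unitaryGroup (hwu u); linarith
    · have h1 := hreal N w hw
      have h2 := hreal N 1 (one_mem _)
      rw [conjTranspose_one, ← h N, h1, Complex.ofReal_inj] at h2
      exact h2.symm
    · have hne : (w * R u).trace.re ≠ n := fun he => by
        have h1 := eq_one_of_trace_re_eq (hwu u) he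
        apply hcon u⁻¹
        calc R u⁻¹ = w * R u * R u⁻¹ := by rw [h1, one_mul]
          _ = w := by rw [mul_assoc, ← map_mul]; simp
      have := lt_of_le_of_ne (trace_re_le_of_mem_unitaryGroup (hwu u)) hne
      simp only [map_one, mul_one, trace_one, Fintype.card_fin, Complex.natCast_re]
      linarith

/-! ### Identity theorem, Liouville argument and the stabilizer group of the separating functions -/

theorem Complex.eq_of_eqOn_real {F : Type*} [NormedAddCommGroup F] [NormedSpace ℂ F]
    [CompleteSpace F] {f g : ℂ → F} (hf : Differentiable ℂ f) (hg : Differentiable ℂ g)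
    (h : ∀ t : ℝ, f t = g t) : f = g := by
  refine AnalyticOnNhd.eq_of_frequently_eq (z₀ := 0) (fun z _ => hf.analyticAt z)
    (fun z _ => hg.analyticAt z) ?_
  have ht : Filter.Tendsto (fun t : ℝ => (t : ℂ)) (𝓝[≠] 0) (𝓝[≠] 0) := by
    refine tendsto_nhdsWithin_of_tendsto_nhds_of_eventually_within _ ?_ ?_
    · exact (Complex.continuous_ofReal.tendsto' 0 0 (by simp)).mono_left nhdsWithin_le_nhds
    · filter_upwards [self_mem_nhdsWithin] with t ht
      simpa using ht
  exact ht.frequently (Filter.Eventually.of_forall h).frequently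

theorem Matrix.exp_smul_I_mem_unitaryGroup {Y : Mat} (hY : Y.IsHermitian) (s : ℝ) :
    exp ((s * Complex.I : ℂ) • Y) ∈ unitaryGroup (Fin n) ℂ := by
  rw [mem_unitaryGroup_iff', star_eq_conjTranspose, ← exp_conjTranspose, conjTranspose_smul, hY.eq]
  have : star (s * Complex.I : ℂ) = -(s * Complex.I) := by simp
  rw [this, neg_smul, ← exp_add_of_commute (-((s * Complex.I : ℂ) • Y)) _ (Commute.neg_left (Commute.refl _))]
  simp

theorem Matrix.norm_le_of_mem_unitaryGroup {V : Mat} (hV : V ∈ unitaryGroup (Fin n) ℂ) :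
    ‖V‖ ≤ 1 + ‖(1 : Mat)‖ := by
  have h := CStarRing.norm_star_mul_self (x := V)
  rw [mem_unitaryGroup_iff'.1 hV] at h
  nlinarith [norm_nonneg V]

theorem Matrix.differentiable_exp_smul (Y : Mat) :
    Differentiable ℂ (fun z : ℂ => exp (z • Y)) := fun z =>
  (hasDerivAt_exp_smul_const Y z).differentiableAt

/-- For Hermitian `Y` the factor `exp (i Im z Y)` is unitary, so only `Re z`, which ranges over a
compact interval, affects the size. -/
theorem Matrix.exists_norm_exp_smul_le {Y : Mat} (hY : Y.IsHermitian) :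
    ∃ C, ∀ z : ℂ, |z.re| ≤ 1 → ‖exp (z • Y)‖ ≤ C := by
  have hc : Continuous fun t : ℝ => exp ((t : ℂ) • Y) :=
    (differentiable_exp_smul Y).continuous.comp Complex.continuous_ofReal
  obtain ⟨C, hC⟩ := (isCompact_Icc (a := (-1 : ℝ)) (b := 1)).exists_bound_of_continuousOn
    hc.continuousOn
  refine ⟨C * (1 + ‖(1 : Mat)‖), fun z hz => ?_⟩
  have h1 : exp (z • Y) = exp ((z.re : ℂ) • Y) * exp ((z.im * Complex.I : ℂ) • Y) := by
    rw [← exp_add_of_commute _ _ ((Commute.refl Y).smul_left _ |>.smul_right _), ← add_smul,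
      Complex.re_add_im]
  rw [h1]
  refine (norm_mul_le _ _).trans ?_
  have h2 := hC z.re (abs_le.1 hz)
  have h0 := (norm_nonneg _).trans h2
  gcongr
  exact norm_le_of_mem_unitaryGroup (exp_smul_I_mem_unitaryGroup hY _)

theorem Matrix.exp_add_smul (z w : ℂ) (Y : Mat) :
    exp ((z + w) • Y) = exp (z • Y) * exp (w • Y) := by
  rw [← exp_add_of_commute _ _ ((Commute.refl Y).smul_left _ |>.smul_right _), ← add_smul]

theorem Matrix.exp_neg_smul_mul (z : ℂ) (Y : Mat) : exp (-z • Y) * exp (z • Y) = 1 := by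
  rw [← exp_add_smul]; simp

/-- A holomorphic function on `{(g, g⁻¹)}` invariant under `exp Y` with `Y` Hermitian is constant
along `exp (z Y)`, by periodicity and Liouville's theorem. -/
theorem Matrix.eq_const_of_invariant_exp {J : Mat × Mat → ℂ} (hJ : Differentiable ℂ J) {Y : Mat}
    (hY : Y.IsHermitian) (h : ∀ a b, J (a * exp Y, exp (-Y) * b) = J (a, b)) (z : ℂ) :
    J (exp (z • Y), exp (-z • Y)) = J (1, 1) := by
  set F : ℂ → ℂ := fun z => J (exp (z • Y), exp (-z • Y)) with hF
  have hper : Function.Periodic F 1 := fun z => by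
    have := h (exp (z • Y)) (exp (-z • Y))
    rw [hF]
    simp only
    rw [← this, exp_add_smul, one_smul, neg_add, add_comm (-z), exp_add_smul, neg_smul, one_smul]
  have hd : Differentiable ℂ F := hJ.comp
    ((differentiable_exp_smul Y).prodMk ((differentiable_exp_smul Y).comp differentiable_neg))
  obtain ⟨C, hC⟩ := exists_norm_exp_smul_le hY
  have hcomp : IsCompact (Metric.closedBall (0 : Mat) C ×ˢ Metric.closedBall (0 : Mat) C) := by
    have : ProperSpace Mat := FiniteDimensional.proper ℂ _
    exact (isCompact_closedBall _ _).prod (isCompact_closedBall _ _)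
  have hb : Bornology.IsBounded (Set.range F) := by
    refine (hcomp.image hJ.continuous).isBounded.subset ?_
    rintro _ ⟨z, rfl⟩
    -- Periodicity moves `z` into the strip where both `exp (z Y)` and `exp (-z Y)` are bounded.
    have hz : F z = F (z - (⌊z.re⌋ : ℤ)) := by
      have := hper.sub_int_mul_eq (x := z) ⌊z.re⌋
      simpa using this.symm
    have hre : |(z - (⌊z.re⌋ : ℤ)).re| ≤ 1 := by
      have h1 : (z - (⌊z.re⌋ : ℤ)).re = Int.fract z.re := by
        rw [Complex.sub_re, Complex.intCast_re, Int.self_sub_floor]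
      rw [h1, abs_of_nonneg (Int.fract_nonneg _)]
      exact (Int.fract_lt_one _).le
    rw [hz]
    refine ⟨_, ⟨?_, ?_⟩, rfl⟩
    · simpa using hC _ hre
    · simpa using hC (-(z - (⌊z.re⌋ : ℤ))) (by rw [Complex.neg_re, abs_neg]; exact hre)
  have := hd.apply_eq_apply_of_bounded hb z 0
  simpa [hF] using this

/-- A substitute for the Zariski closure of a compact group of unitary matrices: a closed group of
matrices which has no further unitary elements. -/
theorem exists_closed_subgroup_unitary {U : Type*} [Group U] [TopologicalSpace U]
    [IsTopologicalGroup U] [CompactSpace U] (R : U →* GL (Fin n) ℂ)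
    (hR : Continuous fun u => (R u : Mat))
    (hRu : ∀ u, (R u : Mat) ∈ unitaryGroup (Fin n) ℂ) :
    ∃ Γ : Subgroup (GL (Fin n) ℂ), IsClosed (Γ : Set (GL (Fin n) ℂ)) ∧ (∀ u, R u ∈ Γ) ∧
      (∀ c : ℂ → GL (Fin n) ℂ, Differentiable ℂ (fun z => (c z : Mat)) →
        Differentiable ℂ (fun z => ((c z)⁻¹ : GL (Fin n) ℂ).val) →
        (∀ t : ℝ, c t ∈ Γ) → ∀ z, c z ∈ Γ) ∧
      (∀ w ∈ Γ, (w : Mat) ∈ unitaryGroup (Fin n) ℂ → ∃ u, R u = w) ∧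
      (∀ Y : Mat, Y.IsHermitian → ∀ γ ∈ Γ, (γ : Mat) = exp Y →
        ∀ s : ℝ, ∃ u, (R u : Mat) = exp ((s * Complex.I : ℂ) • Y)) := by
  obtain ⟨J, hJ, hinv, hsep⟩ := exists_separating_holomorphic
    ((Units.coeHom Mat).comp R) hR hRu
  have hinvR : ∀ g : GL (Fin n) ℂ, (g : Mat) ∈ unitaryGroup (Fin n) ℂ →
      (g⁻¹ : GL (Fin n) ℂ).val = (g : Mat)ᴴ := fun g hg => by
    rw [Units.inv_eq_of_mul_eq_one_left]
    exact mem_unitaryGroup_iff'.1 hg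
  -- Invariance is required at every pair `(a, b)`, not only at inverse pairs: this makes the
  -- stabilizer a group at once.
  let Γ : Subgroup (GL (Fin n) ℂ) :=
    { carrier := {γ | ∀ N a b, J N (a * γ, (γ⁻¹ : GL (Fin n) ℂ).val * b) = J N (a, b)}
      one_mem' := by simp
      mul_mem' := fun {γ δ} hγ hδ N a b => by
        rw [← hγ N a b, ← hδ N (a * (γ : Mat)) ((γ⁻¹ : GL (Fin n) ℂ).val * b)]
        simp only [Units.val_mul, _root_.mul_inv_rev, mul_assoc]
      inv_mem' := fun {γ} hγ N a b => by
        rw [← hγ]; simp [mul_assoc, -coe_units_inv] }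
  refine ⟨Γ, ?_, fun u N a b => ?_, fun c hc hc' hΓ z N a b => ?_, fun w hw hwu => ?_,
    fun Y hY γ hγ hγY s => ?_⟩
  · have : (Γ : Set (GL (Fin n) ℂ)) = ⋂ N, ⋂ a, ⋂ b,
        {γ : GL (Fin n) ℂ | J N (a * (γ : Mat), (γ⁻¹ : GL (Fin n) ℂ).val * b) = J N (a, b)} := by
      ext γ; simp [Γ]
    rw [this]
    refine isClosed_iInter fun N => isClosed_iInter fun a => isClosed_iInter fun b =>
      isClosed_eq ((hJ N).continuous.comp ?_) continuous_const
    exact (continuous_const.mul Units.continuous_val).prodMk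
      ((Units.continuous_val.comp continuous_inv).mul continuous_const)
  · rw [hinvR _ (hRu u)]
    exact hinv N u a b
  · have h1 : Differentiable ℂ fun z => J N (a * c z, ((c z)⁻¹ : GL (Fin n) ℂ).val * b) :=
      (hJ N).comp (((differentiable_const a).mul hc).prodMk (hc'.mul (differentiable_const b)))
    exact congrFun (Complex.eq_of_eqOn_real h1 (differentiable_const (J N (a, b)))
      fun t => hΓ t N a b) z
  · obtain ⟨u, hu⟩ := hsep w hwu fun N => by
      have := hw N 1 1
      rwa [one_mul, mul_one, hinvR w hwu] at this
    exact ⟨u, Units.ext hu⟩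
  -- `J N` is constant along `exp (z Y)`; at `z = i s` that matrix is unitary, so the separation
  -- property places it in the compact group.
  · have hw := exp_smul_I_mem_unitaryGroup hY s
    have hinvY : (γ⁻¹ : GL (Fin n) ℂ).val = exp (-Y) := by
      rw [Units.inv_eq_of_mul_eq_one_left]
      rw [hγY]
      simpa using exp_neg_smul_mul 1 Y
    obtain ⟨u, hu⟩ := hsep _ hw fun N => by
      have := eq_const_of_invariant_exp (hJ N) hY (fun a b => by
        have := hγ N a b
        rwa [hγY, hinvY] at this) (s * Complex.I)
      rw [← this, ← exp_conjTranspose, conjTranspose_smul, hY.eq]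
      congr 3
      simp
    exact ⟨u, hu⟩

/-! ### Invariant Hermitian forms -/

/-- The form is the Haar average of `R l (R l)ᴴ`; left translation invariance of the measure absorbs
the congruence by `R k`. -/
theorem exists_posDef_invariant {L : Type*} [Group L] [TopologicalSpace L]
    [IsTopologicalGroup L] [CompactSpace L] (R : L →* GL (Fin n) ℂ)
    (hR : Continuous fun u => (R u : Mat)) :
    ∃ q : Mat, q.PosDef ∧ ∀ l, (R l : Mat) * q * (R l : Mat)ᴴ = q := by
  obtain ⟨m, hm, μ, hμ1, hμ2, hμ3⟩ := exists_invariant_probability L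
  have hcont : Continuous fun l => (R l : Mat) * (R l : Mat)ᴴ := hR.mul hR.matrix_conjTranspose
  have hint : Integrable (fun l => (R l : Mat) * (R l : Mat)ᴴ) μ :=
    hcont.integrable_of_hasCompactSupport (HasCompactSupport.of_compactSpace _)
  have hlin : ∀ Λ : Mat →ₗ[ℝ] ℂ, Λ (∫ l, (R l : Mat) * (R l : Mat)ᴴ ∂μ) =
      ∫ l, Λ ((R l : Mat) * (R l : Mat)ᴴ) ∂μ := fun Λ =>
    ((LinearMap.toContinuousLinearMap Λ).integral_comp_comm hint).symm
  have hlin' : ∀ Λ : Mat →ₗ[ℝ] Mat, Λ (∫ l, (R l : Mat) * (R l : Mat)ᴴ ∂μ) =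
      ∫ l, Λ ((R l : Mat) * (R l : Mat)ᴴ) ∂μ := fun Λ =>
    ((LinearMap.toContinuousLinearMap Λ).integral_comp_comm hint).symm
  refine ⟨∫ l, (R l : Mat) * (R l : Mat)ᴴ ∂μ, ?_, fun k => ?_⟩
  · refine PosDef.of_dotProduct_mulVec_pos ?_ fun x hx => ?_
    · have := hlin' { toFun := fun A => Aᴴ, map_add' := conjTranspose_add,
                      map_smul' := fun r A => by ext; simp }
      simp only [LinearMap.coe_mk, AddHom.coe_mk] at this
      rw [IsHermitian, this]
      simp
    · have h1 := hlin { toFun := fun A => star x ⬝ᵥ A *ᵥ x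
                        map_add' := fun A B => by simp [add_mulVec]
                        map_smul' := fun r A => by simp [smul_mulVec] }
      simp only [LinearMap.coe_mk, AddHom.coe_mk] at h1
      have hpd : ∀ l, 0 < star x ⬝ᵥ ((R l : Mat) * (R l : Mat)ᴴ) *ᵥ x := fun l =>
        (PosDef.mul_conjTranspose_self _
          (vecMul_injective_of_isUnit (R l).isUnit)).dotProduct_mulVec_pos hx
      have h2 : ∀ l, star x ⬝ᵥ ((R l : Mat) * (R l : Mat)ᴴ) *ᵥ x =
          (((star x ⬝ᵥ ((R l : Mat) * (R l : Mat)ᴴ) *ᵥ x).re : ℝ) : ℂ) := fun l =>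
        Complex.eq_re_of_ofReal_le (r := 0) (by simpa using (hpd l).le)
      rw [h1, integral_congr_ae (.of_forall h2)]
      have h3 : 0 < ∫ l, (star x ⬝ᵥ ((R l : Mat) * (R l : Mat)ᴴ) *ᵥ x).re ∂μ := by
        refine Continuous.integral_pos_of_hasCompactSupport_nonneg_nonzero (x := 1) ?_
          (HasCompactSupport.of_compactSpace _) (fun l => ?_) ?_
        · refine Complex.continuous_re.comp ?_
          exact continuous_const.dotProduct (hcont.matrix_mulVec continuous_const)
        · exact (Complex.pos_iff.1 (hpd l)).1.le
        · exact (Complex.pos_iff.1 (hpd 1)).1.ne'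
      have h4 := integral_complex_ofReal (μ := μ)
        (f := fun l => (star x ⬝ᵥ ((R l : Mat) * (R l : Mat)ᴴ) *ᵥ x).re)
      rw [show (∫ l, (((star x ⬝ᵥ ((R l : Mat) * (R l : Mat)ᴴ) *ᵥ x).re : ℝ) : ℂ) ∂μ) = _ from h4]
      exact Complex.zero_lt_real.2 h3
  · have := hlin' ((LinearMap.mulRight ℝ (R k : Mat)ᴴ).comp (LinearMap.mulLeft ℝ (R k : Mat)))
    simp only [LinearMap.coe_comp, Function.comp_apply, LinearMap.mulLeft_apply,
      LinearMap.mulRight_apply] at this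
    rw [this, ← integral_mul_left_eq_self (fun l => (R l : Mat) * (R l : Mat)ᴴ) k]
    refine integral_congr_ae (.of_forall fun l => ?_)
    simp [mul_assoc]

end MatrixAnalysis

/-! ### Faithful holomorphic representations are immersions -/

section LieGroups

open scoped Matrix.Norms.L2Operator
open NormedSpace Matrix Topology Filter

variable {E : Type*} [NormedAddCommGroup E] [NormedSpace ℂ E]
  {G : Type*} [TopologicalSpace G] [ChartedSpace E G] [Group G] {n : ℕ}

local notation "Mat" => Matrix (Fin n) (Fin n) ℂ

omit [Group G] in
theorem contMDiff_matrix_of_entries {f : G → Mat}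
    (h : ∀ i j, ContMDiff 𝓘(ℂ, E) 𝓘(ℂ, ℂ) ω (fun g => f g i j)) :
    ContMDiff 𝓘(ℂ, E) 𝓘(ℂ, Mat) ω f := by
  have h1 : ContMDiff 𝓘(ℂ, E) 𝓘(ℂ, Fin n → Fin n → ℂ) ω (fun g i j => f g i j) :=
    contMDiff_pi_space.2 fun i => contMDiff_pi_space.2 fun j => h i j
  let L : (Fin n → Fin n → ℂ) →ₗ[ℂ] Mat := (LinearMap.id : Mat →ₗ[ℂ] Mat)
  exact (LinearMap.toContinuousLinearMap L).contDiff.contMDiff.comp h1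

section Chart

variable [LieGroup 𝓘(ℂ, E) ω G]

theorem contDiffAt_comp_extChartAt_symm {F : Type*} [NormedAddCommGroup F] [NormedSpace ℂ F]
    {f : G → F} (hf : ContMDiff 𝓘(ℂ, E) 𝓘(ℂ, F) ω f) :
    ContDiffAt ℂ ω (f ∘ (extChartAt 𝓘(ℂ, E) (1 : G)).symm)
      (extChartAt 𝓘(ℂ, E) (1 : G) 1) := by
  rw [← contMDiffAt_iff_contDiffAt]
  have h := (contMDiffOn_extChartAt_symm (I := 𝓘(ℂ, E)) (n := ω) (1 : G)).contMDiffAt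
    (extChartAt_target_mem_nhds (I := 𝓘(ℂ, E)) (1 : G))
  exact (hf _).comp _ h

/-- The multiplication of a Lie group in the chart at `1`. -/
noncomputable def chartMul (E : Type*) [NormedAddCommGroup E] [NormedSpace ℂ E]
    (G : Type*) [TopologicalSpace G] [ChartedSpace E G] [Group G] (p : E × E) : E :=
  extChartAt 𝓘(ℂ, E) (1 : G) ((extChartAt 𝓘(ℂ, E) (1 : G)).symm p.1 *
    (extChartAt 𝓘(ℂ, E) (1 : G)).symm p.2)

variable (E G) in
theorem contDiffAt_chartMul :
    ContDiffAt ℂ ω (chartMul E G)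
      (extChartAt 𝓘(ℂ, E) (1 : G) 1, extChartAt 𝓘(ℂ, E) (1 : G) 1) := by
  rw [← contMDiffAt_iff_contDiffAt]
  have h := (contMDiffOn_extChartAt_symm (I := 𝓘(ℂ, E)) (n := ω) (1 : G)).contMDiffAt
    (extChartAt_target_mem_nhds (I := 𝓘(ℂ, E)) (1 : G))
  set x₀ := extChartAt 𝓘(ℂ, E) (1 : G) 1
  have h1 : ContMDiffAt 𝓘(ℂ, E × E) 𝓘(ℂ, E) ω
      (fun p : E × E => (extChartAt 𝓘(ℂ, E) (1 : G)).symm p.1) (x₀, x₀) :=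
    ContMDiffAt.comp (x₀, x₀) (f := Prod.fst) h contDiffAt_fst.contMDiffAt
  have h2 : ContMDiffAt 𝓘(ℂ, E × E) 𝓘(ℂ, E) ω
      (fun p : E × E => (extChartAt 𝓘(ℂ, E) (1 : G)).symm p.2) (x₀, x₀) :=
    ContMDiffAt.comp (x₀, x₀) (f := Prod.snd) h contDiffAt_snd.contMDiffAt
  refine ContMDiffAt.comp (x₀, x₀) (g := extChartAt 𝓘(ℂ, E) (1 : G)) ?_ (h1.mul h2)
  apply contMDiffAt_extChartAt'
  simp [x₀]

/-- An injective holomorphic representation is an immersion at `1`. -/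
theorem injective_fderiv_of_injective [FiniteDimensional ℂ E] {ρ : G →* GL (Fin n) ℂ}
    (hinj : Function.Injective ρ)
    (hρ : ContMDiff 𝓘(ℂ, E) 𝓘(ℂ, Mat) ω (fun g => (ρ g : Mat))) :
    Function.Injective (fderiv ℂ ((fun g => (ρ g : Mat)) ∘ (extChartAt 𝓘(ℂ, E) (1 : G)).symm)
      (extChartAt 𝓘(ℂ, E) (1 : G) 1)) := by
  have : CompleteSpace E := FiniteDimensional.complete ℂ E
  have : IsTopologicalGroup G := topologicalGroup_of_lieGroup 𝓘(ℂ, E) ω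
  let _ : NormedSpace ℝ E := NormedSpace.restrictScalars ℝ ℂ E
  set e := extChartAt 𝓘(ℂ, E) (1 : G) with he
  set x₀ := e 1 with hx₀
  set F : E → Mat := (fun g => (ρ g : Mat)) ∘ e.symm with hF
  have hFd : ContDiffAt ℂ ω F x₀ := contDiffAt_comp_extChartAt_symm hρ
  have hm : ContDiffAt ℂ ω (chartMul E G) (x₀, x₀) := contDiffAt_chartMul E G
  have hsymm : e.symm x₀ = 1 := extChartAt_to_inv (I := 𝓘(ℂ, E)) 1
  have htarget : ∀ᶠ x in 𝓝 x₀, x ∈ e.target := extChartAt_target_mem_nhds (I := 𝓘(ℂ, E)) (1 : G)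
  have hsource : ∀ᶠ g in 𝓝 (1 : G), g ∈ e.source := extChartAt_source_mem_nhds (I := 𝓘(ℂ, E)) (1 : G)
  have hcs : ContinuousAt e.symm x₀ := continuousAt_extChartAt_symm (I := 𝓘(ℂ, E)) (1 : G)
  rw [injective_iff_map_eq_zero]
  intro X hX
  -- the left invariant vector field in the direction `X`
  set v : E → E := fun x => fderiv ℂ (chartMul E G) (x, x₀) (0, X) with hv
  have hv1 : ContDiffAt ℂ 1 v x₀ := by
    have h1 : ContDiffAt ℂ 1 (fderiv ℂ (chartMul E G)) (x₀, x₀) := hm.fderiv_right le_top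
    have h2 : ContDiffAt ℂ 1 (fun x : E => fderiv ℂ (chartMul E G) (x, x₀)) x₀ :=
      ContDiffAt.comp x₀ (f := fun x : E => (x, x₀)) h1 (contDiffAt_id.prodMk contDiffAt_const)
    exact h2.clm_apply contDiffAt_const
  have hmd : ∀ᶠ x in 𝓝 x₀, DifferentiableAt ℂ (chartMul E G) (x, x₀) := by
    have h1 : ∀ᶠ p in 𝓝 (x₀, x₀), ContDiffAt ℂ 1 (chartMul E G) p :=
      (hm.of_le le_top).eventually (by simp)
    have h2 : Tendsto (fun x : E => (x, x₀)) (𝓝 x₀) (𝓝 (x₀, x₀)) :=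
      (continuous_id.prodMk continuous_const).tendsto _
    filter_upwards [h2.eventually h1] with x hx using hx.differentiableAt (by simp)
  have hFd' : ∀ᶠ x in 𝓝 x₀, DifferentiableAt ℂ F x := by
    filter_upwards [(hFd.of_le (m := 1) le_top).eventually (by simp)] with x hx
      using hx.differentiableAt (by simp)
  have hmul : ∀ᶠ x in 𝓝 x₀, ∀ᶠ y in 𝓝 x₀, F (chartMul E G (x, y)) = F x * F y := by
    have h1 : Tendsto (fun p : E × E => e.symm p.1 * e.symm p.2) (𝓝 (x₀, x₀)) (𝓝 1) := by
      have h2 : Tendsto (fun p : E × E => e.symm p.1) (𝓝 (x₀, x₀)) (𝓝 (e.symm x₀)) :=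
        hcs.tendsto.comp continuous_fst.continuousAt
      have h3 : Tendsto (fun p : E × E => e.symm p.2) (𝓝 (x₀, x₀)) (𝓝 (e.symm x₀)) :=
        hcs.tendsto.comp continuous_snd.continuousAt
      simpa [hsymm] using h2.mul h3
    have h4 := h1.eventually hsource
    rw [nhds_prod_eq] at h4
    filter_upwards [h4.curry] with x hx
    filter_upwards [hx] with y hy
    simp only [hF, Function.comp, chartMul]
    rw [e.left_inv hy, map_mul]; simp
  have hmx : ∀ᶠ x in 𝓝 x₀, chartMul E G (x, x₀) = x := by
    filter_upwards [htarget] with x hx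
    simp only [chartMul]
    rw [hsymm, mul_one, e.right_inv hx]
  -- Differentiating `F (x y) = F x * F y` in `y` at the identity, along `X`, gives `dF_x (v x) = F
  -- x * dF_{x₀} X = 0`.
  have hzero : ∀ᶠ x in 𝓝 x₀, HasFDerivAt F (fderiv ℂ F x) x ∧ fderiv ℂ F x (v x) = 0 := by
    filter_upwards [hmd, hFd', hmul, hmx] with x h1 h2 h3 h4
    refine ⟨h2.hasFDerivAt, ?_⟩
    have h5 : HasFDerivAt (fun y => chartMul E G (x, y))
        ((fderiv ℂ (chartMul E G) (x, x₀)).comp (ContinuousLinearMap.inr ℂ E E)) x₀ :=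
      h1.hasFDerivAt.comp x₀ (hasFDerivAt_prodMk_right x x₀)
    have h6 : HasFDerivAt F (fderiv ℂ F x) (chartMul E G (x, x₀)) := by
      rw [h4]; exact h2.hasFDerivAt
    have h7 := h6.comp x₀ h5
    have h8 : HasFDerivAt (fun y => F x * F y) (F x • fderiv ℂ F x₀) x₀ :=
      (hFd.differentiableAt (by simp)).hasFDerivAt.const_mul (F x)
    have h9 := (h8.congr_of_eventuallyEq h3).unique h7
    have h10 := congrArg (fun T => T X) h9
    simp only [_root_.smul_apply, hX, smul_zero] at h10
    simpa [hv] using h10.symm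
  obtain ⟨α, hα0, ε, hε, hα⟩ :=
    (hv1.restrict_scalars ℝ).exists_forall_mem_closedBall_exists_eq_forall_mem_Ioo_hasDerivAt₀ 0
  have hα00 := hα 0 (by simp [hε])
  have hαt : Tendsto α (𝓝 0) (𝓝 x₀) := by
    have := hα00.continuousAt.tendsto; rwa [hα0] at this
  obtain ⟨δ, hδ, hδ'⟩ := Metric.eventually_nhds_iff_ball.1
    ((hαt.eventually hzero).and ((hαt.eventually htarget).and
      (Ioo_mem_nhds (by simpa using hε) (by simpa using hε) : Set.Ioo (0 - ε) (0 + ε) ∈ 𝓝 (0 : ℝ))))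
  -- `F` is constant along the integral curve `α` of `v`, and injectivity of `ρ` makes the curve
  -- itself constant. Its velocity at `0`, which is `X`, therefore vanishes.
  have hconst : ∀ t ∈ Metric.ball (0 : ℝ) δ, α t = x₀ := by
    have hd : ∀ t ∈ Metric.ball (0 : ℝ) δ, HasDerivAt (F ∘ α) 0 t := fun t ht => by
      obtain ⟨⟨h1, h2⟩, _, h3⟩ := hδ' t ht
      have := (h1.restrictScalars ℝ).comp_hasDerivAt t (hα t h3)
      simpa [h2] using this
    intro t ht
    have h0 : (0 : ℝ) ∈ Metric.ball (0 : ℝ) δ := Metric.mem_ball_self hδ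
    have h1 : (F ∘ α) t = (F ∘ α) 0 :=
      Metric.isOpen_ball.is_const_of_deriv_eq_zero (convex_ball _ _).isPreconnected
        (fun s hs => (hd s hs).differentiableAt.differentiableWithinAt)
        (fun s hs => (hd s hs).deriv) ht h0
    have h2 : e.symm (α t) = 1 := by
      rw [← hsymm, ← hα0]
      exact hinj (Units.ext h1)
    rw [← e.right_inv (hδ' t ht).2.1, h2]
  have h1 : HasDerivAt α 0 0 := by
    refine (hasDerivAt_const (0 : ℝ) x₀).congr_of_eventuallyEq ?_
    filter_upwards [Metric.ball_mem_nhds (0 : ℝ) hδ] with t ht using hconst t ht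
  have h2 : v x₀ = 0 := by
    rw [← hα0]; exact hα00.unique h1
  have h3 : v x₀ = X := by
    have h5 : HasFDerivAt (fun y => chartMul E G (x₀, y))
        ((fderiv ℂ (chartMul E G) (x₀, x₀)).comp (ContinuousLinearMap.inr ℂ E E)) x₀ :=
      (hm.differentiableAt (by simp)).hasFDerivAt.comp x₀ (hasFDerivAt_prodMk_right x₀ x₀)
    have h6 : (fun y => chartMul E G (x₀, y)) =ᶠ[𝓝 x₀] id := by
      filter_upwards [htarget] with x hx
      simp only [chartMul]
      rw [hsymm, one_mul, e.right_inv hx, id]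
    have := h5.unique ((hasFDerivAt_id x₀).congr_of_eventuallyEq h6)
    simpa [hv] using congrArg (fun T => T X) this
  rw [← h3, h2]

/-- Local holomorphic left inverse of an injective representation. -/
theorem exists_local_left_inverse [FiniteDimensional ℂ E] {ρ : G →* GL (Fin n) ℂ}
    (hinj : Function.Injective ρ)
    (hρ : ContMDiff 𝓘(ℂ, E) 𝓘(ℂ, Mat) ω (fun g => (ρ g : Mat))) :
    ∃ (L : Mat →L[ℂ] E) (s : E → G), ContMDiffAt 𝓘(ℂ, E) 𝓘(ℂ, E) ω s (L 1) ∧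
      (∀ᶠ g in 𝓝 (1 : G), s (L (ρ g)) = g) ∧
      ∀ X, L (fderiv ℂ ((fun g => (ρ g : Mat)) ∘ (extChartAt 𝓘(ℂ, E) (1 : G)).symm)
        (extChartAt 𝓘(ℂ, E) (1 : G) 1) X) = X := by
  have : CompleteSpace E := FiniteDimensional.complete ℂ E
  have hd := injective_fderiv_of_injective hinj hρ
  have hFd := contDiffAt_comp_extChartAt_symm hρ
  set e := extChartAt 𝓘(ℂ, E) (1 : G) with he
  set x₀ := e 1 with hx₀
  set F : E → Mat := (fun g => (ρ g : Mat)) ∘ e.symm with hF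
  have hsymm : e.symm x₀ = 1 := extChartAt_to_inv (I := 𝓘(ℂ, E)) 1
  -- Composing `F` with a linear left inverse of its differential gives derivative the identity, so
  -- the inverse function theorem applies between copies of `E`.
  obtain ⟨L', hL'⟩ := LinearMap.exists_leftInverse_of_injective (fderiv ℂ F x₀ : E →ₗ[ℂ] Mat)
    (LinearMap.ker_eq_bot.2 hd)
  let L : Mat →L[ℂ] E := LinearMap.toContinuousLinearMap L'
  have hL : ∀ X, L (fderiv ℂ F x₀ X) = X := fun X => LinearMap.congr_fun hL' X
  have hH : ContDiffAt ℂ ω (L ∘ F) x₀ := L.contDiff.contDiffAt.comp x₀ hFd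
  have hH' : HasFDerivAt (L ∘ F) ((ContinuousLinearEquiv.refl ℂ E : E ≃L[ℂ] E) : E →L[ℂ] E) x₀ := by
    have := L.hasFDerivAt.comp x₀ (hFd.differentiableAt (by simp)).hasFDerivAt
    convert this using 1
    ext X
    exact (hL X).symm
  have hF0 : (L ∘ F) x₀ = L 1 := by simp [hF, hsymm]
  have hinv := hH.to_localInverse hH' (by simp)
  have hinv0 := hH.localInverse_apply_image hH' (by simp)
  set σ := hH.localInverse hH' (by simp) with hσ
  have hleft : ∀ᶠ x in 𝓝 x₀, σ ((L ∘ F) x) = x :=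
    (hH.hasStrictFDerivAt' hH' (by simp)).eventually_left_inverse
  rw [hF0] at hinv hinv0
  refine ⟨L, fun y => e.symm (σ y), ?_, ?_, hL⟩
  · have h := (contMDiffOn_extChartAt_symm (I := 𝓘(ℂ, E)) (n := ω) (1 : G)).contMDiffAt
      (extChartAt_target_mem_nhds (I := 𝓘(ℂ, E)) (1 : G))
    refine ContMDiffAt.comp (L 1) (g := e.symm) (f := σ) ?_ hinv.contMDiffAt
    rw [hinv0]; exact h
  · have ht : Tendsto e (𝓝 1) (𝓝 x₀) := continuousAt_extChartAt (I := 𝓘(ℂ, E)) (1 : G)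
    filter_upwards [ht.eventually hleft, extChartAt_source_mem_nhds (I := 𝓘(ℂ, E)) (1 : G)]
      with g hg hgs
    have h1 : e.symm (e g) = g := e.left_inv hgs
    simp only [hF, Function.comp, h1] at hg
    rw [hg, h1]

end Chart
end LieGroups

/-! ### Holomorphic one-parameter subgroups and the groups they generate -/

section LieGroups

open scoped Matrix.Norms.L2Operator
open NormedSpace Matrix Topology Filter ComplexLie

variable {E : Type*} [NormedAddCommGroup E] [NormedSpace ℂ E]
  {G : Type*} [TopologicalSpace G] [ChartedSpace E G] [Group G] {n : ℕ}

local notation "Mat" => Matrix (Fin n) (Fin n) ℂ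

section OneParam

variable {φ : ℂ → G} {X : E} {ρ : G →* GL (Fin n) ℂ}

theorem ComplexLie.IsOneParam.map_zero (h : IsOneParam E φ X) : φ 0 = 1 := by
  have := h.map_add 0 0
  rwa [add_zero, left_eq_mul] at this

theorem ComplexLie.IsOneParam.map_neg (h : IsOneParam E φ X) (z : ℂ) : φ (-z) = (φ z)⁻¹ := by
  rw [eq_inv_iff_mul_eq_one, ← h.map_add, neg_add_cancel, h.map_zero]

theorem ComplexLie.IsOneParam.differentiable_rep (h : IsOneParam E φ X)
    (hρ : ContMDiff 𝓘(ℂ, E) 𝓘(ℂ, Mat) ω (fun g => (ρ g : Mat))) :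
    Differentiable ℂ (fun z => (ρ (φ z) : Mat)) :=
  (hρ.comp h.holomorphic).contDiff.differentiable (by simp)

theorem ComplexLie.IsOneParam.differentiable_rep_inv (h : IsOneParam E φ X)
    (hρ : ContMDiff 𝓘(ℂ, E) 𝓘(ℂ, Mat) ω (fun g => (ρ g : Mat))) :
    Differentiable ℂ (fun z => ((ρ (φ z))⁻¹ : GL (Fin n) ℂ).val) := by
  have : (fun z => ((ρ (φ z))⁻¹ : GL (Fin n) ℂ).val) = fun z => (ρ (φ (-z)) : Mat) := by
    ext1 z; rw [h.map_neg, _root_.map_inv]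
  rw [this]
  exact (h.differentiable_rep hρ).comp differentiable_neg

theorem ComplexLie.exists_isOneParam [LieGroup 𝓘(ℂ, E) ω G]
    (hφ : ContMDiff 𝓘(ℂ, ℂ) 𝓘(ℂ, E) ω φ)
    (hadd : ∀ z w, φ (z + w) = φ z * φ w) : ∃ X, IsOneParam E φ X := by
  have h0 : φ 0 = 1 := by
    have := hadd 0 0
    rwa [add_zero, left_eq_mul] at this
  refine ⟨_, hφ, hadd, DifferentiableAt.hasDerivAt ?_⟩
  have h1 : ContMDiffAt 𝓘(ℂ, E) 𝓘(ℂ, E) ω (extChartAt 𝓘(ℂ, E) (1 : G)) (φ 0) := by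
    rw [h0]; exact contMDiffAt_extChartAt
  exact (h1.comp (0 : ℂ) (hφ 0)).contDiffAt.differentiableAt (by simp)

theorem ComplexLie.IsOneParam.comp_mul [LieGroup 𝓘(ℂ, E) ω G] (h : IsOneParam E φ X) (c : ℂ) :
    ∃ X', IsOneParam E (fun z => φ (c * z)) X' := by
  refine exists_isOneParam (h.holomorphic.comp ?_) fun z w => by rw [mul_add, h.map_add]
  exact (contDiff_const.mul contDiff_id).contMDiff

theorem ComplexLie.IsOneParam.conj [LieGroup 𝓘(ℂ, E) ω G] (h : IsOneParam E φ X) (σ : G) :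
    ∃ X', IsOneParam E (fun z => σ * φ z * σ⁻¹) X' :=
  exists_isOneParam ((contMDiff_const.mul h.holomorphic).mul contMDiff_const)
    fun z w => by rw [h.map_add]; group

theorem ComplexLie.IsOneParam.hasStrictDerivAt_rep [LieGroup 𝓘(ℂ, E) ω G]
    (h : IsOneParam E φ X)
    (hρ : ContMDiff 𝓘(ℂ, E) 𝓘(ℂ, Mat) ω (fun g => (ρ g : Mat))) :
    HasStrictDerivAt (fun z => (ρ (φ z) : Mat))
      (fderiv ℂ ((fun g => (ρ g : Mat)) ∘ (extChartAt 𝓘(ℂ, E) (1 : G)).symm)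
        (extChartAt 𝓘(ℂ, E) (1 : G) 1) X) 0 := by
  have hFd := contDiffAt_comp_extChartAt_symm hρ
  have h1 : HasDerivAt (fun z => (ρ (φ z) : Mat))
      (fderiv ℂ ((fun g => (ρ g : Mat)) ∘ (extChartAt 𝓘(ℂ, E) (1 : G)).symm)
        (extChartAt 𝓘(ℂ, E) (1 : G) 1) X) 0 := by
    have h2 : HasFDerivAt ((fun g => (ρ g : Mat)) ∘ (extChartAt 𝓘(ℂ, E) (1 : G)).symm)
      (fderiv ℂ ((fun g => (ρ g : Mat)) ∘ (extChartAt 𝓘(ℂ, E) (1 : G)).symm)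
        (extChartAt 𝓘(ℂ, E) (1 : G) 1)) (extChartAt 𝓘(ℂ, E) (1 : G) (φ 0)) := by
      rw [h.map_zero]
      exact (hFd.differentiableAt (by simp)).hasFDerivAt
    refine (h2.comp_hasDerivAt (0 : ℂ) h.velocity).congr_of_eventuallyEq ?_
    have hc : Tendsto φ (𝓝 0) (𝓝 1) := h.holomorphic.continuous.tendsto' _ _ h.map_zero
    filter_upwards [hc.eventually (extChartAt_source_mem_nhds (I := 𝓘(ℂ, E)) (1 : G))] with z hz
    simp only [Function.comp]
    rw [(extChartAt 𝓘(ℂ, E) (1 : G)).left_inv hz]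
  have h3 := ((h.differentiable_rep hρ).analyticAt 0).hasStrictDerivAt
  rwa [h1.deriv] at h3

end OneParam

variable [LieGroup 𝓘(ℂ, E) ω G] {ρ : G →* GL (Fin n) ℂ}

/-- One-parameter groups whose velocities span the Lie algebra generate a connected group. -/
theorem ComplexLie.complexification_eq_top [FiniteDimensional ℂ E] [ConnectedSpace G]
    (hinj : Function.Injective ρ)
    (hρ : ContMDiff 𝓘(ℂ, E) 𝓘(ℂ, Mat) ω (fun g => (ρ g : Mat)))
    {U : Subgroup G} (hU : Submodule.span ℂ (lieAlgebraOf E U) = ⊤) :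
    complexification E U = ⊤ := by
  classical
  have : CompleteSpace E := FiniteDimensional.complete ℂ E
  have : IsTopologicalGroup G := topologicalGroup_of_lieGroup 𝓘(ℂ, E) ω
  obtain ⟨L, s, -, hs, hL⟩ := exists_local_left_inverse hinj hρ
  set D := fderiv ℂ ((fun g => (ρ g : Mat)) ∘ (extChartAt 𝓘(ℂ, E) (1 : G)).symm)
        (extChartAt 𝓘(ℂ, E) (1 : G) 1) with hD
  let b := Module.Basis.ofSpan hU.ge
  have hb : ∀ j, b j ∈ lieAlgebraOf E U := fun j => Module.Basis.ofSpan_subset hU.ge ⟨j, rfl⟩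
  choose φ hφ hφU using hb
  have : Fintype _ := FiniteDimensional.fintypeBasisIndex b
  set H := complexification E U
  have hφH : ∀ j z, φ j z ∈ H := fun j z =>
    Subgroup.subset_closure (Or.inr ⟨φ j, b j, z, hφ j, hφU j, rfl⟩)
  -- `Φ x` is a product of the values `φ j (ξ_j x)`, with `ξ_j` the coordinates in a basis drawn
  -- from the Lie algebra of `U` (coordinates of the second kind). The derivative at `0` is built up
  -- one factor at a time.
  have key : ∀ t : Finset _, ∃ Φ : E → G, Φ 0 = 1 ∧ Continuous Φ ∧ (∀ x, Φ x ∈ H) ∧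
      HasStrictFDerivAt (fun x => (ρ (Φ x) : Mat))
        (D.comp (∑ j ∈ t, (LinearMap.toContinuousLinearMap (b.coord j)).smulRight (b j))) 0 := by
    intro t
    induction t using Finset.induction_on with
    | empty => exact ⟨fun _ => 1, rfl, continuous_const, fun _ => one_mem _, by
        simpa using hasStrictFDerivAt_const (1 : Mat) (0 : E)⟩
    | insert j t hj ih =>
      obtain ⟨Φ, h0, hc, hH, hd⟩ := ih
      set ξ := LinearMap.toContinuousLinearMap (b.coord j) with hξ
      refine ⟨fun x => φ j (ξ x) * Φ x, ?_, ?_, fun x => mul_mem (hφH _ _) (hH x), ?_⟩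
      · simp [h0, (hφ j).map_zero]
      · exact ((hφ j).holomorphic.continuous.comp ξ.continuous).mul hc
      · have h1 : HasStrictFDerivAt (fun x => (ρ (φ j (ξ x)) : Mat)) (ξ.smulRight (D (b j))) 0 := by
          have h2 := (hφ j).hasStrictDerivAt_rep hρ
          rw [← map_zero ξ] at h2
          have h3 := h2.hasStrictFDerivAt.comp (0 : E) ξ.hasStrictFDerivAt
          refine h3.congr_fderiv ?_
          ext1 x; simp [hD]
        have h4 := h1.mul' hd
        have h5 : (fun x => (ρ (φ j (ξ x) * Φ x) : Mat)) =
            (fun x => (ρ (φ j (ξ x)) : Mat)) * fun x => (ρ (Φ x) : Mat) := by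
          ext1 x; simp
        rw [h5]
        refine h4.congr_fderiv ?_
        rw [Finset.sum_insert hj]
        generalize ∑ k ∈ t, (LinearMap.toContinuousLinearMap (b.coord k)).smulRight (b k) = S
        have e1 : (ρ (φ j (ξ 0)) : Mat) = 1 := by
          rw [_root_.map_zero ξ, (hφ j).map_zero, map_one, Units.val_one]
        have e2 : (ρ (Φ 0) : Mat) = 1 := by rw [h0, map_one, Units.val_one]
        rw [e1, e2, MulOpposite.op_one, one_smul, one_smul, ContinuousLinearMap.comp_add, add_comm]
        congr 1
        ext1 x
        exact (map_smul D (ξ x) (b j)).symm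
  obtain ⟨Φ, h0, hc, hH, hd⟩ := key Finset.univ
  have hsum : ∑ j, (LinearMap.toContinuousLinearMap (b.coord j)).smulRight (b j) =
      ContinuousLinearMap.id ℂ E := by
    ext x
    simp [b.sum_repr x]
  rw [hsum, ContinuousLinearMap.comp_id] at hd
  have hd' : HasStrictFDerivAt (fun x => L (ρ (Φ x) : Mat)) (ContinuousLinearMap.id ℂ E) 0 := by
    have := L.hasStrictFDerivAt.comp (0 : E) hd
    refine this.congr_fderiv ?_
    ext x; exact hL x
  have hmap := hd'.map_nhds_eq_of_surj (by
    rw [ContinuousLinearMap.coe_id]; exact LinearMap.range_id)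
  rw [h0, map_one, Units.val_one] at hmap
  have hΦ : Tendsto Φ (𝓝 0) (𝓝 1) := hc.tendsto' _ _ h0
  have h1 : ∀ᶠ y in 𝓝 (L 1), ∃ x, s (L (ρ (Φ x))) = Φ x ∧ L (ρ (Φ x)) = y := by
    rw [← hmap, eventually_map]
    filter_upwards [hΦ.eventually hs] with x hx using ⟨x, hx, rfl⟩
  have hcont : Tendsto (fun g => L (ρ g : Mat)) (𝓝 1) (𝓝 (L 1)) :=
    (L.continuous.comp hρ.continuous).tendsto' _ _ (by simp)
  -- Near `1` an element is determined by its image under `L ∘ ρ`, and every value near `L 1` is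
  -- attained by some `Φ x ∈ H`.
  have hnhds : (H : Set G) ∈ 𝓝 (1 : G) := by
    filter_upwards [hs, hcont.eventually h1] with g hg hx
    obtain ⟨x, hx1, hx2⟩ := hx
    rw [← hg, ← hx2, hx1]
    exact hH x
  have hopen : IsOpen (H : Set G) := Subgroup.isOpen_of_mem_nhds H hnhds
  have hclopen : IsClopen (H : Set G) := ⟨Subgroup.isClosed_of_isOpen H hopen, hopen⟩
  rw [← Subgroup.coe_eq_univ]
  exact hclopen.eq_univ ⟨1, one_mem H⟩

/-- A continuous one-parameter group extends to a holomorphic one. -/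
theorem ComplexLie.exists_isOneParam_extension [FiniteDimensional ℂ E]
    (hinj : Function.Injective ρ)
    (hρ : ContMDiff 𝓘(ℂ, E) 𝓘(ℂ, Mat) ω (fun g => (ρ g : Mat)))
    {A : Mat} {ψ : ℝ → G} (hψ : Tendsto ψ (𝓝 0) (𝓝 1))
    (hψA : ∀ t : ℝ, (ρ (ψ t) : Mat) = exp ((t : ℂ) • A)) :
    ∃ (φ : ℂ → G) (X : E), IsOneParam E φ X ∧ ∀ z, (ρ (φ z) : Mat) = exp (z • A) := by
  obtain ⟨L, s, hs, hsl, -⟩ := exists_local_left_inverse hinj hρ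
  set c : ℂ → Mat := fun z => exp (z • A) with hc
  have hcd : Differentiable ℂ c := differentiable_exp_smul A
  have hc0 : c 0 = 1 := by simp [hc]
  have hLc : ContMDiffAt 𝓘(ℂ, ℂ) 𝓘(ℂ, E) ω (fun z => L (c z)) 0 :=
    (L.contDiff.comp hcd.contDiff).contMDiff 0
  have hsc : ContMDiffAt 𝓘(ℂ, ℂ) 𝓘(ℂ, E) ω (fun z => s (L (c z))) 0 := by
    refine ContMDiffAt.comp (0 : ℂ) (g := s) ?_ hLc
    rw [hc0]; exact hs
  have hf : AnalyticAt ℂ (fun z => (ρ (s (L (c z))) : Mat)) 0 := by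
    have : ContMDiffAt 𝓘(ℂ, ℂ) 𝓘(ℂ, Mat) ω (fun z => (ρ (s (L (c z))) : Mat)) 0 :=
      (hρ _).comp (0 : ℂ) hsc
    exact this.contDiffAt.analyticAt
  have hreal : ∀ᶠ t : ℝ in 𝓝 0, (ρ (s (L (c t))) : Mat) = c t := by
    filter_upwards [hψ.eventually hsl] with t ht
    rw [hψA] at ht
    change (ρ (s (L (exp ((t : ℂ) • A)))) : Mat) = exp ((t : ℂ) • A)
    rw [ht, hψA]
  -- Agreement for small real times spreads to a complex neighbourhood by the identity theorem.
  have hev : ∀ᶠ z in 𝓝 (0 : ℂ), (ρ (s (L (c z))) : Mat) = c z := by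
    rw [← hf.frequently_eq_iff_eventually_eq (hcd.analyticAt 0)]
    have ht : Tendsto (fun t : ℝ => (t : ℂ)) (𝓝[≠] 0) (𝓝[≠] 0) := by
      refine tendsto_nhdsWithin_of_tendsto_nhds_of_eventually_within _ ?_ ?_
      · exact (Complex.continuous_ofReal.tendsto' 0 0 (by simp)).mono_left nhdsWithin_le_nhds
      · filter_upwards [self_mem_nhdsWithin] with t ht
        simpa using ht
    exact ht.frequently (hreal.filter_mono nhdsWithin_le_nhds).frequently
  have hrange : ∀ z, ∃ g, (ρ g : Mat) = c z := by
    intro z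
    have ht : Tendsto (fun k : ℕ => ((k : ℂ) + 1)⁻¹ * z) atTop (𝓝 0) := by
      have h1 := (tendsto_one_div_add_atTop_nhds_zero_nat (𝕜 := ℂ)).mul_const z
      simpa using h1
    obtain ⟨k, hk⟩ := (ht.eventually hev).exists
    -- For large `k` the point `z / (k + 1)` lies in the neighbourhood where the lift exists; its
    -- `(k + 1)`-st power lifts `exp (z A)`.
    refine ⟨s (L (c (((k : ℂ) + 1)⁻¹ * z))) ^ (k + 1), ?_⟩
    rw [map_pow, Units.val_pow_eq_pow_val, hk, hc]
    simp only
    rw [← Matrix.exp_nsmul, ← Nat.cast_smul_eq_nsmul ℂ, smul_smul]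
    congr 2
    push_cast
    have : (k : ℂ) + 1 ≠ 0 := by exact_mod_cast Nat.succ_ne_zero k
    field_simp
  choose φ hφ using hrange
  have hadd : ∀ z w, φ (z + w) = φ z * φ w := fun z w => by
    apply hinj; ext1
    rw [map_mul, Units.val_mul, hφ, hφ, hφ]
    exact exp_add_smul z w A
  have hφ0 : ContMDiffAt 𝓘(ℂ, ℂ) 𝓘(ℂ, E) ω φ 0 := by
    refine hsc.congr_of_eventuallyEq ?_
    filter_upwards [hev] with z hz
    apply hinj; ext1
    rw [hφ, hz]
  have hφs : ContMDiff 𝓘(ℂ, ℂ) 𝓘(ℂ, E) ω φ := by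
    intro z₀
    have h1 : φ = fun z => φ z₀ * φ (z - z₀) := by
      ext1 z; rw [← hadd, add_sub_cancel]
    rw [h1]
    refine contMDiffAt_const.mul ?_
    refine ContMDiffAt.comp z₀ (g := φ) (f := fun z => z - z₀) ?_
      (contDiff_id.sub contDiff_const).contMDiff.contMDiffAt
    simpa using hφ0
  obtain ⟨X, hX⟩ := exists_isOneParam hφs hadd
  exact ⟨φ, X, hX, hφ⟩

end LieGroups

/-! ### Positive definite matrices and the convexity of the trace energy -/

section PositiveMatrices

open scoped Matrix.Norms.L2Operator ComplexOrder MatrixOrder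
open NormedSpace Matrix Topology

variable {n : ℕ}

local notation "Mat" => Matrix (Fin n) (Fin n) ℂ

namespace Matrix

theorem PosDef.exists_exp_eq {M : Mat} (hM : M.PosDef) : ∃ Y : Mat, Y.IsHermitian ∧ exp Y = M :=
  ⟨CFC.log M, IsSelfAdjoint.log, CFC.exp_log M (isStrictlyPositive_iff_posDef.2 hM)⟩

theorem IsHermitian.exp_injective {Y Z : Mat} (hY : Y.IsHermitian) (hZ : Z.IsHermitian)
    (h : NormedSpace.exp Y = NormedSpace.exp Z) : Y = Z := by
  rw [← CFC.log_exp Y hY, h, CFC.log_exp Z hZ]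

theorem exp_half_mul_self (Y : Mat) : exp ((1 / 2 : ℂ) • Y) * exp ((1 / 2 : ℂ) • Y) = exp Y := by
  rw [← exp_add_smul]; norm_num

theorem IsHermitian.ofReal_smul {Y : Mat} (hY : Y.IsHermitian) (t : ℝ) :
    ((t : ℂ) • Y).IsHermitian := by
  rw [IsHermitian, conjTranspose_smul, hY.eq]; simp

theorem IsHermitian.half_smul {Y : Mat} (hY : Y.IsHermitian) :
    ((1 / 2 : ℂ) • Y).IsHermitian := by
  simpa using hY.ofReal_smul (1 / 2)

/-- The exponential as an invertible matrix. -/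
noncomputable def expGL (Y : Mat) : GL (Fin n) ℂ where
  val := exp Y
  inv := exp (-Y)
  val_inv := by simpa using exp_neg_smul_mul (-1) Y
  inv_val := by simpa using exp_neg_smul_mul 1 Y

theorem IsHermitian.posDef_exp {Y : Mat} (hY : Y.IsHermitian) : (NormedSpace.exp Y).PosDef := by
  have h := hY.half_smul.exp
  rw [← exp_half_mul_self Y]
  nth_rw 1 [← h.eq]
  exact PosDef.conjTranspose_mul_self _
    (mulVec_injective_of_isUnit (expGL ((1 / 2 : ℂ) • Y)).isUnit)

theorem PosSemidef.posDef_units {p : GL (Fin n) ℂ} (hp : (p : Mat).PosSemidef) :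
    (p : Mat).PosDef := hp.posDef_iff_isUnit.2 p.isUnit

/-- A positive definite matrix has an invertible Hermitian square root. -/
theorem PosDef.exists_isHermitian_mul_self {q : Mat} (hq : q.PosDef) :
    ∃ b : GL (Fin n) ℂ, (b : Mat).IsHermitian ∧ (b : Mat) * b = q := by
  obtain ⟨Y, hY, rfl⟩ := hq.exists_exp_eq
  exact ⟨expGL ((1 / 2 : ℂ) • Y), hY.half_smul.exp, exp_half_mul_self Y⟩

theorem IsHermitian.units_inv {b : GL (Fin n) ℂ} (hb : (b : Mat).IsHermitian) :
    ((b⁻¹ : GL (Fin n) ℂ) : Mat).IsHermitian := by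
  rw [coe_units_inv]; exact hb.inv

theorem PosSemidef.units_inv {p : GL (Fin n) ℂ} (hp : (p : Mat).PosSemidef) :
    ((p⁻¹ : GL (Fin n) ℂ) : Mat).PosSemidef := by
  rw [coe_units_inv]; exact hp.inv

theorem isClosed_posSemidef : IsClosed {A : Mat | A.PosSemidef} := by
  simp only [← nonneg_iff_posSemidef]
  exact CStarAlgebra.isClosed_nonneg

theorem PosSemidef.exists_conjTranspose_mul_self {A : Mat} (hA : A.PosSemidef) :
    ∃ C : Mat, A = Cᴴ * C :=
  CStarAlgebra.nonneg_iff_eq_star_mul_self.1 (nonneg_iff_posSemidef.2 hA)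

theorem re_trace_conjTranspose_mul_self (D : Mat) :
    (Dᴴ * D).trace.re = ∑ i, ∑ j, ‖D j i‖ ^ 2 := by
  simp only [trace, diag_apply, mul_apply, conjTranspose_apply, Complex.re_sum]
  refine Finset.sum_congr rfl fun i _ => Finset.sum_congr rfl fun j _ => ?_
  rw [RCLike.star_def, ← Complex.normSq_eq_conj_mul_self, Complex.ofReal_re, Complex.normSq_eq_norm_sq]

theorem re_trace_conjTranspose_mul_self_nonneg (D : Mat) : 0 ≤ (Dᴴ * D).trace.re := by
  rw [re_trace_conjTranspose_mul_self]; positivity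

theorem trace_sandwich_eq {b : GL (Fin n) ℂ} (hb : (b : Mat).IsHermitian) (C : Mat) :
    ((b : Mat) * b * (Cᴴ * C)).trace = ((C * (b : Mat))ᴴ * (C * (b : Mat))).trace := by
  rw [conjTranspose_mul, hb.eq, mul_assoc, trace_mul_comm]
  simp only [mul_assoc]

theorem PosSemidef.re_trace_mul_nonneg {b : GL (Fin n) ℂ} (hb : (b : Mat).IsHermitian) {A : Mat}
    (hA : A.PosSemidef) : 0 ≤ ((b : Mat) * b * A).trace.re := by
  obtain ⟨C, rfl⟩ := hA.exists_conjTranspose_mul_self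
  rw [trace_sandwich_eq hb]
  exact re_trace_conjTranspose_mul_self_nonneg _

/-- The positive semidefinite matrices with bounded trace form a bounded set. -/
theorem exists_isCompact_of_re_trace_le {b : GL (Fin n) ℂ} (hb : (b : Mat).IsHermitian) (c : ℝ) :
    ∃ B : Set Mat, IsCompact B ∧
      ∀ A : Mat, A.PosSemidef → ((b : Mat) * b * A).trace.re ≤ c → A ∈ B := by
  -- The radius `1 + |c|` serves because `x ^ 2 ≤ c` implies `x ≤ 1 + |c|`. Writing `A = Cᴴ C`, the
  -- trace is the squared Hilbert–Schmidt norm of `C b`.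
  let S : Set Mat := Set.univ.pi fun _ => Set.univ.pi fun _ => Metric.closedBall (0 : ℂ) (1 + |c|)
  have hS : IsCompact S := isCompact_univ_pi fun _ => isCompact_univ_pi fun _ =>
    isCompact_closedBall _ _
  let f : Mat → Mat := fun D => (D * (b⁻¹ : GL (Fin n) ℂ).val)ᴴ * (D * (b⁻¹ : GL (Fin n) ℂ).val)
  have hf : Continuous f := by
    have : Continuous fun D : Mat => D * (b⁻¹ : GL (Fin n) ℂ).val := continuous_id.mul continuous_const
    exact this.matrix_conjTranspose.mul this
  refine ⟨f '' S, hS.image hf, fun A hA hAc => ?_⟩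
  obtain ⟨C, rfl⟩ := hA.exists_conjTranspose_mul_self
  rw [trace_sandwich_eq hb, re_trace_conjTranspose_mul_self] at hAc
  refine ⟨C * (b : Mat), fun j _ i _ => ?_, ?_⟩
  · rw [mem_closedBall_zero_iff]
    have h1 : ‖(C * (b : Mat)) j i‖ ^ 2 ≤ c :=
      (Finset.single_le_sum (f := fun j => ‖(C * (b : Mat)) j i‖ ^ 2)
        (fun _ _ => by positivity) (Finset.mem_univ j)).trans
      ((Finset.single_le_sum (f := fun i => ∑ j, ‖(C * (b : Mat)) j i‖ ^ 2)
        (fun _ _ => by positivity) (Finset.mem_univ i)).trans hAc)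
    have h2 := le_abs_self c
    nlinarith [norm_nonneg ((C * (b : Mat)) j i)]
  · simp only [f]
    rw [Units.mul_inv_cancel_right]

/-- The energy of a positive definite matrix `p` relative to `q = b ^ 2`. -/
noncomputable def traceEnergy (b p : GL (Fin n) ℂ) : ℝ :=
  ((b : Mat) * b * (p⁻¹ : GL (Fin n) ℂ).val).trace.re +
    ((b⁻¹ : GL (Fin n) ℂ).val * (b⁻¹ : GL (Fin n) ℂ).val * (p : Mat)).trace.re

theorem continuous_traceEnergy (b : GL (Fin n) ℂ) : Continuous (traceEnergy b) := by
  have h1 : Continuous fun p : GL (Fin n) ℂ => (p⁻¹ : GL (Fin n) ℂ).val :=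
    Units.continuous_val.comp continuous_inv
  exact (Complex.continuous_re.comp (continuous_const.mul h1).matrix_trace).add
    (Complex.continuous_re.comp (continuous_const.mul Units.continuous_val).matrix_trace)

/-- The two summands are nonnegative, so a bound on the energy bounds both `p` and `p⁻¹`; sublevel
sets are then compact inside the invertible matrices. -/
theorem exists_isMinOn_traceEnergy {b : GL (Fin n) ℂ} (hb : (b : Mat).IsHermitian)
    {P : Set (GL (Fin n) ℂ)} (hP : IsClosed P) (hpos : ∀ p ∈ P, (p : Mat).PosSemidef)
    {p₁ : GL (Fin n) ℂ} (hp₁ : p₁ ∈ P) : ∃ p₀ ∈ P, ∀ p ∈ P, traceEnergy b p₀ ≤ traceEnergy b p := by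
  obtain ⟨B₁, hB₁, h₁⟩ := exists_isCompact_of_re_trace_le hb (traceEnergy b p₁)
  obtain ⟨B₂, hB₂, h₂⟩ := exists_isCompact_of_re_trace_le hb.units_inv (traceEnergy b p₁)
  have hK : IsCompact (Units.embedProduct Mat ⁻¹' (B₂ ×ˢ (MulOpposite.unop ⁻¹' B₁))) :=
    Units.isClosedEmbedding_embedProduct.isCompact_preimage
      (hB₂.prod (MulOpposite.opHomeomorph.symm.isClosedEmbedding.isCompact_preimage hB₁))
  have hS : IsCompact (P ∩ {p | traceEnergy b p ≤ traceEnergy b p₁}) := by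
    refine hK.of_isClosed_subset
      (hP.inter (isClosed_le (continuous_traceEnergy b) continuous_const)) ?_
    rintro p ⟨hp, hle⟩
    have h3 := (hpos p hp).units_inv.re_trace_mul_nonneg hb
    have h4 := (hpos p hp).re_trace_mul_nonneg hb.units_inv
    simp only [Set.mem_ofPred_eq] at hle
    rw [traceEnergy] at hle
    have h5 : (p : Mat) ∈ B₂ := h₂ _ (hpos p hp) (by linarith)
    have h6 : (p⁻¹ : GL (Fin n) ℂ).val ∈ B₁ := h₁ _ (hpos p hp).units_inv (by linarith)
    exact ⟨h5, h6⟩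
  obtain ⟨p₀, ⟨hp₀, h5⟩, h6⟩ := hS.exists_isMinOn ⟨p₁, hp₁, le_refl (traceEnergy b p₁)⟩
    (continuous_traceEnergy b).continuousOn
  refine ⟨p₀, hp₀, fun p hp => ?_⟩
  by_cases h : traceEnergy b p ≤ traceEnergy b p₁
  · exact h6 ⟨hp, h⟩
  · exact h5.trans (not_le.1 h).le

theorem trace_one_sub_mul_mul_one_sub (B w : Mat) :
    ((1 - w) * B * (1 - w)).trace = B.trace + (B * (w * w)).trace - 2 * (B * w).trace := by
  have h1 : (w * B).trace = (B * w).trace := trace_mul_comm _ _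
  have h2 : (w * B * w).trace = (B * (w * w)).trace := by
    rw [mul_assoc, trace_mul_comm, mul_assoc]
  have h3 : (1 - w) * B * (1 - w) = B - w * B - B * w + w * B * w := by noncomm_ring
  rw [h3, trace_add, trace_sub, trace_sub, h1, h2]
  ring

/-- Strict convexity of the energy along geodesics, in midpoint form. -/
theorem eq_one_of_traceEnergy_le {b s w : GL (Fin n) ℂ} (hb : (b : Mat).IsHermitian)
    (hs : (s : Mat).IsHermitian) (hw : (w : Mat).IsHermitian)
    (h : traceEnergy b (s * s) + traceEnergy b (s * (w * w) * s) ≤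
      2 * traceEnergy b (s * w * s)) : w = 1 := by
  -- The convexity defect `E(s²) + E(s w² s) - 2 E(s w s)` is the sum of the squared Hilbert–Schmidt
  -- norms of `D₁` and `D₂`; the hypothesis forces `D₂ = 0`.
  set D₁ : Mat := b * (s⁻¹ : GL (Fin n) ℂ).val * (1 - (w⁻¹ : GL (Fin n) ℂ).val) with hD₁
  set D₂ : Mat := (b⁻¹ : GL (Fin n) ℂ).val * s * (1 - (w : Mat)) with hD₂
  have hsi := hs.units_inv
  have hwi := hw.units_inv
  have hbi := hb.units_inv
  have key : ∀ x c v : GL (Fin n) ℂ, (x : Mat).IsHermitian → (c : Mat).IsHermitian →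
      (v : Mat).IsHermitian →
      (((c : Mat) * (x : Mat) * (1 - (v : Mat)))ᴴ * ((c : Mat) * (x : Mat) * (1 - (v : Mat)))).trace =
        ((c : Mat) * c * (x * x : GL (Fin n) ℂ)).trace +
          ((c : Mat) * c * (x * (v * v) * x : GL (Fin n) ℂ)).trace -
          2 * ((c : Mat) * c * (x * v * x : GL (Fin n) ℂ)).trace := by
    intro x c v hx hc hv
    have h1 : ((c : Mat) * (x : Mat) * (1 - (v : Mat)))ᴴ * ((c : Mat) * (x : Mat) * (1 - (v : Mat))) =
        (1 - (v : Mat)) * ((x : Mat) * (c : Mat) * (c : Mat) * (x : Mat)) * (1 - (v : Mat)) := by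
      simp only [conjTranspose_mul, conjTranspose_sub, conjTranspose_one, hx.eq, hc.eq, hv.eq,
        mul_assoc]
    have h2 : ∀ M : Mat, ((c : Mat) * c * (x * M * x)).trace = (x * c * c * x * M).trace := by
      intro M
      rw [← mul_assoc, trace_mul_comm]
      simp only [mul_assoc]
    have h3 := h2 1
    rw [mul_one, mul_one] at h3
    rw [h1, trace_one_sub_mul_mul_one_sub]
    simp only [Units.val_mul]
    rw [h2, h2, h3]
  have k1 := congrArg Complex.re (key s⁻¹ b w⁻¹ hsi hb hwi)
  have k2 := congrArg Complex.re (key s b⁻¹ w hs hbi hw)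
  have e1 : s⁻¹ * s⁻¹ = (s * s)⁻¹ := by group
  have e2 : s⁻¹ * (w⁻¹ * w⁻¹) * s⁻¹ = (s * (w * w) * s)⁻¹ := by group
  have e3 : s⁻¹ * w⁻¹ * s⁻¹ = (s * w * s)⁻¹ := by group
  rw [e1, e2, e3, ← hD₁] at k1
  rw [← hD₂] at k2
  have n1 := re_trace_conjTranspose_mul_self_nonneg D₁
  have n2 := re_trace_conjTranspose_mul_self_nonneg D₂
  simp only [traceEnergy] at h
  have r2 : ∀ z : ℂ, (2 * z).re = 2 * z.re := fun z => by simp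
  simp only [Complex.sub_re, Complex.add_re, r2] at k1 k2
  have hz : (D₂ᴴ * D₂).trace.re = 0 := by linarith
  have hz' : (D₂ᴴ * D₂).trace = 0 := by
    have := (posSemidef_conjTranspose_mul_self D₂).trace_nonneg
    exact Complex.ext hz (Complex.nonneg_iff.1 this).2.symm
  rw [trace_conjTranspose_mul_self_eq_zero_iff, hD₂, mul_assoc, Units.mul_right_eq_zero,
    Units.mul_right_eq_zero, sub_eq_zero] at hz'
  exact Units.ext hz'.symm

/-- Both products whose traces form the energy change only by conjugation. In the application `l'`
is the adjoint of `l` and `l` preserves the form `b * b`. -/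
theorem traceEnergy_congruence {b p l l' : GL (Fin n) ℂ}
    (h : (l : Mat) * (b * b) * l' = b * b) : traceEnergy b (l * p * l') = traceEnergy b p := by
  have h' : l * (b * b) * l' = b * b := Units.ext (by simpa using h)
  have e1 : b * b * (l * p * l')⁻¹ = l * (b * b * p⁻¹) * l⁻¹ := by
    calc b * b * (l * p * l')⁻¹ = (l * (b * b) * l') * (l * p * l')⁻¹ := by rw [h']
      _ = _ := by group
  have e2 : b⁻¹ * b⁻¹ * (l * p * l') = l'⁻¹ * (b⁻¹ * b⁻¹ * p) * l' := by
    calc b⁻¹ * b⁻¹ * (l * p * l') = (b * b)⁻¹ * (l * p * l') := by group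
      _ = (l * (b * b) * l')⁻¹ * (l * p * l') := by rw [h']
      _ = _ := by group
  have t : ∀ x y : GL (Fin n) ℂ, ((x * y * x⁻¹ : GL (Fin n) ℂ) : Mat).trace = (y : Mat).trace := by
    intro x y
    rw [Units.val_mul, trace_mul_comm, ← Units.val_mul]
    congr 2; group
  have t' : ∀ x y : GL (Fin n) ℂ, ((x⁻¹ * y * x : GL (Fin n) ℂ) : Mat).trace = (y : Mat).trace := by
    intro x y
    simpa using t x⁻¹ y
  simp only [traceEnergy, ← Units.val_mul]
  rw [e1, e2, t, t']

/-- If `exp Y` conjugates a unitary matrix to a unitary matrix, then `Y` commutes with it. -/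
theorem IsHermitian.commute_of_conj_mem_unitaryGroup {Y : Mat} (hY : Y.IsHermitian)
    {V : GL (Fin n) ℂ} (hV : (V : Mat) ∈ unitaryGroup (Fin n) ℂ)
    (h : NormedSpace.exp Y * V * NormedSpace.exp (-Y) ∈ unitaryGroup (Fin n) ℂ) : Commute Y (V : Mat) := by
  have hV1 : (V : Mat)ᴴ = (V⁻¹ : GL (Fin n) ℂ).val := by
    rw [Units.inv_eq_of_mul_eq_one_left]
    exact mem_unitaryGroup_iff'.1 hV
  have h1 := mem_unitaryGroup_iff'.1 h
  rw [star_eq_conjTranspose, conjTranspose_mul, conjTranspose_mul, hV1, hY.exp.eq, hY.neg.exp.eq]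
    at h1
  have h2 : (expGL Y)⁻¹ * (V⁻¹ * expGL Y) * (expGL Y * V * (expGL Y)⁻¹) = 1 := Units.ext h1
  -- Unitarity of the conjugate says that `exp (2 Y)` commutes with `V`; uniqueness of the Hermitian
  -- logarithm then passes this to `Y`.
  have h3 : expGL Y * expGL Y = V * (expGL Y * expGL Y) * V⁻¹ := by
    have h4 : V⁻¹ * (expGL Y * expGL Y) * V = expGL Y * expGL Y := by
      calc V⁻¹ * (expGL Y * expGL Y) * V
          = expGL Y * ((expGL Y)⁻¹ * (V⁻¹ * expGL Y) * (expGL Y * V * (expGL Y)⁻¹)) *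
            expGL Y := by group
        _ = _ := by rw [h2, mul_one]
    calc expGL Y * expGL Y = V * (V⁻¹ * (expGL Y * expGL Y) * V) * V⁻¹ := by group
      _ = _ := by rw [h4]
  have h4 : ∀ Z : Mat, NormedSpace.exp Z * NormedSpace.exp Z = NormedSpace.exp ((2 : ℂ) • Z) := fun Z => by
    rw [show (2 : ℂ) = 1 + 1 by norm_num, exp_add_smul, one_smul]
  have h5 : NormedSpace.exp ((2 : ℂ) • Y) = NormedSpace.exp ((V : Mat) * ((2 : ℂ) • Y) * (V⁻¹ : GL (Fin n) ℂ).val) := by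
    have h6 := congrArg Units.val h3
    have h7 : NormedSpace.exp ((V : Mat) * ((2 : ℂ) • Y) * (V⁻¹ : GL (Fin n) ℂ).val) =
        V * NormedSpace.exp ((2 : ℂ) • Y) * (V⁻¹ : GL (Fin n) ℂ).val := by
      rw [coe_units_inv]; exact Matrix.exp_conj _ _ V.isUnit
    rw [h7, ← h4]
    exact h6
  have h2Y : ((2 : ℂ) • Y).IsHermitian := by simpa using hY.ofReal_smul 2
  have h8 := h2Y.exp_injective (by
    rw [← hV1]; exact isHermitian_mul_mul_conjTranspose _ h2Y) h5
  have h9 : (2 : ℂ) • (Y * (V : Mat)) = (2 : ℂ) • ((V : Mat) * Y) := by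
    have := congrArg (· * (V : Mat)) h8
    simp only [Units.inv_mul_cancel_right] at this
    simpa using this
  exact smul_right_injective _ (two_ne_zero (α := ℂ)) h9

end Matrix

end PositiveMatrices

/-! ### Weyl's unitary trick, polar decomposition and Cartan's fixed point theorem -/

section Reductive

open scoped Matrix.Norms.L2Operator ComplexOrder MatrixOrder
open NormedSpace Matrix Topology Filter ComplexLie

variable {E : Type*} [NormedAddCommGroup E] [NormedSpace ℂ E]
  {G : Type*} [TopologicalSpace G] [ChartedSpace E G] [Group G] {n : ℕ}

local notation "Mat" => Matrix (Fin n) (Fin n) ℂ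

theorem ComplexLie.IsOneParam.commute_of_real {φ : ℂ → G} {X : E} {ρ : G →* GL (Fin n) ℂ}
    (h : IsOneParam E φ X) (hinj : Function.Injective ρ)
    (hρ : ContMDiff 𝓘(ℂ, E) 𝓘(ℂ, Mat) ω (fun g => (ρ g : Mat))) {x : G}
    (hx : ∀ t : ℝ, φ t * x = x * φ t) (z : ℂ) : φ z * x = x * φ z := by
  have h1 : (fun z => (ρ (φ z) : Mat) * ρ x) = fun z => (ρ x : Mat) * ρ (φ z) :=
    Complex.eq_of_eqOn_real ((h.differentiable_rep hρ).mul_const _)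
      ((h.differentiable_rep hρ).const_mul _) fun t => by
        rw [← Units.val_mul, ← Units.val_mul, ← map_mul, ← map_mul, hx]
  have h2 := congrFun h1 z
  simp only [← Units.val_mul, ← map_mul] at h2
  exact hinj (Units.ext h2)

/-- Commuting with `exp (t X)` for real `t` extends to complex `t` by the identity theorem, so the
centralizer of `x` contains all generators of `K_ℂ`. -/
theorem ComplexLie.commute_complexification {ρ : G →* GL (Fin n) ℂ} (hinj : Function.Injective ρ)
    (hρ : ContMDiff 𝓘(ℂ, E) 𝓘(ℂ, Mat) ω (fun g => (ρ g : Mat))) {K : Subgroup G} {x : G}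
    (hx : ∀ k ∈ K, k * x = x * k) {g : G} (hg : g ∈ complexification E K) : g * x = x * g := by
  have hle : complexification E K ≤ Subgroup.centralizer {x} := by
    refine (Subgroup.closure_le _).2 ?_
    rintro g (hg | ⟨φ, X, z, hφ, hφK, rfl⟩)
    · exact Subgroup.mem_centralizer_singleton_iff.2 (hx g hg)
    · exact Subgroup.mem_centralizer_singleton_iff.2
        (hφ.commute_of_real hinj hρ (fun t => hx _ (hφK t)) z)
  exact Subgroup.mem_centralizer_singleton_iff.1 (hle hg)

variable (E) in
/-- A faithful holomorphic representation `ρ` of `G` in which `K` is the unitary part and `G` has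
a polar decomposition `G = K exp 𝔭`. -/
structure IsPolarRep (ρ : G →* GL (Fin n) ℂ) (K : Subgroup G) : Prop where
  injective : Function.Injective ρ
  holomorphic : ContMDiff 𝓘(ℂ, E) 𝓘(ℂ, Mat) ω (fun g => (ρ g : Mat))
  isCompact : IsCompact (K : Set G)
  mem_iff : ∀ g, g ∈ K ↔ (ρ g : Mat) ∈ unitaryGroup (Fin n) ℂ
  exists_conjTranspose : ∀ g, ∃ g', (ρ g' : Mat) = (ρ g : Mat)ᴴ
  exists_isOneParam : ∀ Y : Mat, Y.IsHermitian → ∀ g, (ρ g : Mat) = exp Y →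
    ∃ (φ : ℂ → G) (X : E), IsOneParam E φ X ∧ ∀ z, (ρ (φ z) : Mat) = exp (z • Y)
  isClosed_pos : IsClosed {p : GL (Fin n) ℂ | p ∈ ρ.range ∧ (p : Mat).PosSemidef}
  central : ∀ x, (∀ k ∈ K, k * x = x * k) → x ∈ Subgroup.center G

theorem Matrix.conjTranspose_units_of_mem_unitaryGroup {g : GL (Fin n) ℂ}
    (hg : (g : Mat) ∈ unitaryGroup (Fin n) ℂ) : (g : Mat)ᴴ = (g⁻¹ : GL (Fin n) ℂ).val := by
  rw [Units.inv_eq_of_mul_eq_one_left]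
  exact mem_unitaryGroup_iff'.1 hg

section

variable [LieGroup 𝓘(ℂ, E) ω G] [FiniteDimensional ℂ E] {ρ : G →* GL (Fin n) ℂ}

-- On generators the adjoint is explicit: `u⁻¹` for `u ∈ U`, and `φ (-z̄)` for `φ z`, since both
-- sides are holomorphic in `z̄` and agree at real times by unitarity.
omit [LieGroup 𝓘(ℂ, E) ω G] [FiniteDimensional ℂ E] in
theorem exists_conjTranspose_of_complexification {U : Subgroup G}
    (hρ : ContMDiff 𝓘(ℂ, E) 𝓘(ℂ, Mat) ω (fun g => (ρ g : Mat)))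
    (hU : ∀ u ∈ U, (ρ u : Mat) ∈ unitaryGroup (Fin n) ℂ) {g : G}
    (hg : g ∈ complexification E U) : ∃ g', (ρ g' : Mat) = (ρ g : Mat)ᴴ := by
  have hu : ∀ u ∈ U, (ρ u : Mat)ᴴ = (ρ u⁻¹ : Mat) := fun u hu => by
    rw [conjTranspose_units_of_mem_unitaryGroup (hU u hu), _root_.map_inv]
  induction hg using Subgroup.closure_induction with
  | one => exact ⟨1, by simp⟩
  | mem g hg =>
    rcases hg with hg | ⟨φ, X, z, hφ, hφU, rfl⟩
    · exact ⟨g⁻¹, (hu g hg).symm⟩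
    · refine ⟨φ (-(star z)), ?_⟩
      have hd := hφ.differentiable_rep hρ
      have h1 : (star ∘ (fun z => (ρ (φ z) : Mat)) ∘ star) = fun z => (ρ (φ (-z)) : Mat) := by
        refine Complex.eq_of_eqOn_real (fun w => ?_) (hd.comp differentiable_neg) fun t => ?_
        · simpa using (hd (star w)).star_star
        · simp only [Function.comp, RCLike.star_def, Complex.conj_ofReal]
          rw [star_eq_conjTranspose, hu _ (hφU t), hφ.map_neg]
      have h2 := congrFun h1 (star z)
      simp only [Function.comp, star_star, star_eq_conjTranspose] at h2
      exact h2.symm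
  | mul g h _ _ ihg ihh =>
    obtain ⟨g', hg'⟩ := ihg
    obtain ⟨h', hh'⟩ := ihh
    exact ⟨h' * g', by simp [hg', hh']⟩
  | inv g _ ih =>
    obtain ⟨g', hg'⟩ := ih
    refine ⟨g'⁻¹, ?_⟩
    rw [_root_.map_inv, _root_.map_inv, coe_units_inv, coe_units_inv, hg', conjTranspose_nonsing_inv]

/-- Since `G` is generated by `U` and its complexified one-parameter groups, `ρ(G)` lies in the
stabilizer `Γ` of the separating functions and inherits the unitary and positive elements'
properties from it. -/
theorem isPolarRep_of_unitary [ConnectedSpace G] {U : Subgroup G}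
    (hinj : Function.Injective ρ)
    (hρ : ContMDiff 𝓘(ℂ, E) 𝓘(ℂ, Mat) ω (fun g => (ρ g : Mat)))
    (hUc : IsCompact (U : Set G)) (hspan : Submodule.span ℂ (lieAlgebraOf E U) = ⊤)
    (hU : ∀ u ∈ U, (ρ u : Mat) ∈ unitaryGroup (Fin n) ℂ) : IsPolarRep E ρ U := by
  have : IsTopologicalGroup G := topologicalGroup_of_lieGroup 𝓘(ℂ, E) ω
  have : CompactSpace U := isCompact_iff_compactSpace.1 hUc
  have htop := complexification_eq_top hinj hρ hspan
  have hmem : ∀ g, g ∈ complexification E U := fun g => by rw [htop]; trivial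
  have hRc : Continuous fun u : U => (ρ u : Mat) := hρ.continuous.comp continuous_subtype_val
  obtain ⟨Γ, hΓc, hΓU, hΓe, hΓu, hΓh⟩ := exists_closed_subgroup_unitary (ρ.comp U.subtype) hRc
    fun u => hU u u.2
  have hΓ : ∀ g, ρ g ∈ Γ := by
    have hle : complexification E U ≤ Γ.comap ρ := by
      refine (Subgroup.closure_le _).2 ?_
      rintro g (hg | ⟨φ, X, z, hφ, hφU, rfl⟩)
      · exact hΓU ⟨g, hg⟩
      · exact hΓe (fun z => ρ (φ z)) (hφ.differentiable_rep hρ) (hφ.differentiable_rep_inv hρ)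
          (fun t => hΓU ⟨_, hφU t⟩) z
    exact fun g => hle (hmem g)
  have hone : ∀ Y : Mat, Y.IsHermitian → ∀ γ ∈ Γ, (γ : Mat) = exp Y →
      ∃ (φ : ℂ → G) (X : E), IsOneParam E φ X ∧ ∀ z, (ρ (φ z) : Mat) = exp (z • Y) := by
    intro Y hY γ hγ hγY
    choose ψ hψ using hΓh Y hY γ hγ hγY
    -- Compactness of `U` makes `ρ` an embedding on it, so the lift `ψ` of `exp (i s Y)` is
    -- automatically continuous.
    have hemb : IsClosedEmbedding fun u : U => (ρ u : Mat) :=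
      hRc.isClosedEmbedding fun u v huv => Subtype.ext (hinj (Units.ext huv))
    have hψc : Continuous ψ := by
      rw [hemb.isInducing.continuous_iff]
      have h1 : (fun u : U => (ρ u : Mat)) ∘ ψ =
          (fun z : ℂ => exp (z • Y)) ∘ fun s : ℝ => (s * Complex.I : ℂ) := funext hψ
      rw [h1]
      exact (differentiable_exp_smul Y).continuous.comp
        (Complex.continuous_ofReal.mul continuous_const)
    have hψ0 : (ψ 0 : G) = 1 := by
      apply hinj; ext1
      have := hψ 0
      simpa using this
    obtain ⟨φ, X, hφ, hφA⟩ := exists_isOneParam_extension hinj hρ (A := Complex.I • Y)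
      (ψ := fun t => (ψ t : G))
      ((continuous_subtype_val.comp hψc).tendsto' _ _ hψ0) fun t => by
        rw [smul_smul]; exact hψ t
    -- The extension was built for `i Y`; rescaling time by `-i` turns it into the group of `Y`.
    obtain ⟨X', hX'⟩ := hφ.comp_mul (-Complex.I)
    refine ⟨_, X', hX', fun z => ?_⟩
    rw [hφA, smul_smul]
    congr 2
    rw [mul_right_comm, neg_mul, Complex.I_mul_I, neg_neg, one_mul]
  refine ⟨hinj, hρ, hUc, fun g => ⟨hU g, fun hg => ?_⟩, fun g => ?_, fun Y hY g hg => ?_, ?_,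
    fun x hx => ?_⟩
  · obtain ⟨u, hu⟩ := hΓu _ (hΓ g) hg
    rw [← hinj hu]; exact u.2
  · exact exists_conjTranspose_of_complexification hρ hU (hmem g)
  · exact hone Y hY _ (hΓ g) hg
  -- The positive elements of `ρ(G)` and of `Γ` coincide, since a positive `exp Y ∈ Γ` lies on a
  -- one-parameter group in `ρ(G)`. This gives closedness without knowing that `ρ(G)` is closed.
  · have h1 : {p : GL (Fin n) ℂ | p ∈ ρ.range ∧ (p : Mat).PosSemidef} =
        (Γ : Set (GL (Fin n) ℂ)) ∩ (fun p => (p : Mat)) ⁻¹' {A | A.PosSemidef} := by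
      ext p
      constructor
      · rintro ⟨⟨g, rfl⟩, hp⟩
        exact ⟨hΓ g, hp⟩
      · rintro ⟨hpΓ, hp⟩
        have hp' : (p : Mat).PosSemidef := hp
        obtain ⟨Y, hY, hYp⟩ := hp'.posDef_units.exists_exp_eq
        obtain ⟨φ, X, -, hφ⟩ := hone Y hY p hpΓ hYp.symm
        refine ⟨⟨φ 1, Units.ext ?_⟩, hp'⟩
        rw [hφ, one_smul, hYp]
    rw [h1]
    exact hΓc.inter (isClosed_posSemidef.preimage Units.continuous_val)
  · exact Subgroup.mem_center_iff.2 fun g => commute_complexification hinj hρ hx (hmem g)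

/-- Weyl's unitary trick. -/
theorem ComplexLie.IsReductive.exists_isPolarRep [ConnectedSpace G] (hG : IsReductive E G) :
    ∃ (n : ℕ) (ρ : G →* GL (Fin n) ℂ) (U : Subgroup G), IsPolarRep E ρ U := by
  have : IsTopologicalGroup G := topologicalGroup_of_lieGroup 𝓘(ℂ, E) ω
  obtain ⟨⟨n, ρ, hinj, hρ⟩, U, hUc, hspan⟩ := hG
  have hρ' := contMDiff_matrix_of_entries hρ
  have : CompactSpace U := isCompact_iff_compactSpace.1 hUc
  obtain ⟨q, hq, hqU⟩ := exists_posDef_invariant (ρ.comp U.subtype)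
    (hρ'.continuous.comp continuous_subtype_val)
  obtain ⟨b, hb, rfl⟩ := hq.exists_isHermitian_mul_self
  refine ⟨n, (MulAut.conj b⁻¹).toMonoidHom.comp ρ, U, isPolarRep_of_unitary
    ((MulAut.conj b⁻¹).injective.comp hinj) ?_ hUc hspan fun u hu => ?_⟩
  · let L : Matrix (Fin n) (Fin n) ℂ →ₗ[ℂ] Matrix (Fin n) (Fin n) ℂ :=
      (LinearMap.mulRight ℂ (b : Matrix (Fin n) (Fin n) ℂ)).comp
        (LinearMap.mulLeft ℂ (b⁻¹ : GL (Fin n) ℂ).val)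
    have h1 := (LinearMap.toContinuousLinearMap L).contDiff.contMDiff.comp hρ'
    have h2 : (fun g => ((MulAut.conj b⁻¹).toMonoidHom.comp ρ g : Matrix (Fin n) (Fin n) ℂ)) =
        LinearMap.toContinuousLinearMap L ∘ fun g => (ρ g : Matrix (Fin n) (Fin n) ℂ) := by
      ext1 g
      simp [L]
    rw [h2]; exact h1
  · have h1 := hqU ⟨u, hu⟩
    have hbi := hb.units_inv
    rw [mem_unitaryGroup_iff, star_eq_conjTranspose]
    simp only [MonoidHom.comp_apply, MulEquiv.coe_toMonoidHom, MulAut.conj_apply, inv_inv,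
      Units.val_mul, conjTranspose_mul, hb.eq, hbi.eq, Subgroup.subtype_apply] at h1 ⊢
    calc _ = (b⁻¹ : GL (Fin n) ℂ).val * ((ρ u : Matrix (Fin n) (Fin n) ℂ) * (b * b) *
          (ρ u : Matrix (Fin n) (Fin n) ℂ)ᴴ) * (b⁻¹ : GL (Fin n) ℂ).val := by
          simp only [mul_assoc]
      _ = 1 := by rw [h1]; simp only [← mul_assoc, Units.inv_mul, one_mul, Units.mul_inv]

end

namespace IsPolarRep

variable {ρ : G →* GL (Fin n) ℂ} {K : Subgroup G}

theorem exists_exp_of_posSemidef (h : IsPolarRep E ρ K) {g : G} (hg : (ρ g : Mat).PosSemidef) :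
    ∃ (Y : Mat) (φ : ℂ → G) (X : E), Y.IsHermitian ∧ exp Y = (ρ g : Mat) ∧ IsOneParam E φ X ∧
      ∀ z, (ρ (φ z) : Mat) = exp (z • Y) := by
  obtain ⟨Y, hY, hYg⟩ := hg.posDef_units.exists_exp_eq
  obtain ⟨φ, X, hφ⟩ := h.exists_isOneParam Y hY g hYg.symm
  exact ⟨Y, φ, X, hY, hYg, hφ⟩

/-- Every positive element of the image has a positive square root in the image. -/
theorem exists_sqrt (h : IsPolarRep E ρ K) {g : G} (hg : (ρ g : Mat).PosSemidef) :
    ∃ s, (ρ s : Mat).PosSemidef ∧ s * s = g := by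
  obtain ⟨Y, φ, X, hY, hYg, -, hφ⟩ := h.exists_exp_of_posSemidef hg
  refine ⟨φ (1 / 2), ?_, h.injective (Units.ext ?_)⟩
  · rw [hφ]; exact hY.half_smul.posDef_exp.posSemidef
  · rw [map_mul, Units.val_mul, hφ, exp_half_mul_self, hYg]

theorem exists_polar [LieGroup 𝓘(ℂ, E) ω G] (h : IsPolarRep E ρ K) (g : G) :
    ∃ k ∈ K, ∃ (Y : Mat) (φ : ℂ → G) (X : E), Y.IsHermitian ∧ IsOneParam E φ X ∧
      (∀ z, (ρ (φ z) : Mat) = exp (z • Y)) ∧ g = k * φ 1 := by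
  obtain ⟨g', hg'⟩ := h.exists_conjTranspose g
  have hpos : (ρ (g' * g) : Mat).PosSemidef := by
    rw [map_mul, Units.val_mul, hg']
    exact posSemidef_conjTranspose_mul_self _
  obtain ⟨Y, φ, X, hY, hYg, hφ, hφY⟩ := h.exists_exp_of_posSemidef hpos
  obtain ⟨X', hX'⟩ := hφ.comp_mul (1 / 2)
  -- With `exp Y = gᴴ g` in the representation, the positive factor is `exp (Y / 2)` and the unitary
  -- factor is `g exp (-Y / 2)`.
  refine ⟨g * (φ (1 / 2))⁻¹, (h.mem_iff _).2 ?_, _, _, X', hY.half_smul, hX', fun z => ?_, ?_⟩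
  · have hs : (ρ (φ (1 / 2)) : Mat).IsHermitian := by rw [hφY]; exact hY.half_smul.exp
    have hsi := hs.units_inv
    have hsq : φ (1 / 2) * φ (1 / 2) = g' * g := h.injective (Units.ext (by
      rw [map_mul, Units.val_mul, hφY, exp_half_mul_self, hYg]))
    rw [mem_unitaryGroup_iff', star_eq_conjTranspose, map_mul, Units.val_mul, conjTranspose_mul,
      _root_.map_inv, hsi.eq, ← hg', ← Units.val_mul, ← Units.val_mul, ← Units.val_mul,
      ← _root_.map_inv, ← map_mul, ← map_mul, ← map_mul]
    have : (φ (1 / 2))⁻¹ * g' * (g * (φ (1 / 2))⁻¹) = 1 := by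
      calc _ = (φ (1 / 2))⁻¹ * (g' * g) * (φ (1 / 2))⁻¹ := by group
        _ = 1 := by rw [← hsq]; group
    rw [this]; simp
  · rw [hφY, smul_smul, mul_comm]
  · simp

/-- A positive element that conjugates an element of `K` into `K` commutes with it, together with
its one-parameter group. -/
theorem commute_of_conj_mem (h : IsPolarRep E ρ K) {Y : Mat} (hY : Y.IsHermitian) {φ : ℂ → G}
    (hφY : ∀ z, (ρ (φ z) : Mat) = exp (z • Y)) {k : G}
    (hk : k ∈ K) (hkφ : φ 1 * k * φ (-1) ∈ K) (z : ℂ) : k * φ z = φ z * k := by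
  have h1 := (h.mem_iff _).1 hkφ
  rw [map_mul, map_mul, Units.val_mul, Units.val_mul, hφY, hφY, one_smul, neg_one_smul] at h1
  have h2 := hY.commute_of_conj_mem_unitaryGroup ((h.mem_iff k).1 hk) h1
  have h3 : Commute (ρ k : Mat) (exp (z • Y)) := (h2.symm.smul_right z).exp_right
  apply h.injective
  ext1
  rw [map_mul, map_mul, Units.val_mul, Units.val_mul, hφY]
  exact h3

variable [LieGroup 𝓘(ℂ, E) ω G]

/-- Precomposing `ρ` with `g ↦ σ⁻¹ g σ` leaves its image unchanged and moves its unitary part to `σ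
K σ⁻¹`. -/
theorem conj (h : IsPolarRep E ρ K) (σ : G) :
    IsPolarRep E (ρ.comp (MulAut.conj σ⁻¹).toMonoidHom) (K.map (MulAut.conj σ).toMonoidHom) := by
  have : IsTopologicalGroup G := topologicalGroup_of_lieGroup 𝓘(ℂ, E) ω
  have hmem : ∀ g, g ∈ K.map (MulAut.conj σ).toMonoidHom ↔ σ⁻¹ * g * σ ∈ K := fun g => by
    constructor
    · rintro ⟨k, hk, rfl⟩
      have : σ⁻¹ * (σ * k * σ⁻¹) * σ = k := by group
      simpa [this] using hk
    · intro hg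
      refine ⟨_, hg, ?_⟩
      simp [mul_assoc]
  have happ : ∀ g, (ρ.comp (MulAut.conj σ⁻¹).toMonoidHom) g = ρ (σ⁻¹ * g * σ) := fun g => by simp
  have hrange : (ρ.comp (MulAut.conj σ⁻¹).toMonoidHom).range = ρ.range := by
    ext p
    constructor
    · rintro ⟨g, rfl⟩
      exact ⟨_, rfl⟩
    · rintro ⟨g, rfl⟩
      refine ⟨σ * g * σ⁻¹, ?_⟩
      rw [happ]; congr 1; group
  refine ⟨h.injective.comp (MulAut.conj σ⁻¹).injective, ?_, ?_, fun g => ?_, fun g => ?_,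
    fun Y hY g hg => ?_, ?_, fun x hx => ?_⟩
  · simp only [happ]
    exact h.holomorphic.comp ((contMDiff_const.mul contMDiff_id).mul contMDiff_const)
  · have := h.isCompact.image (f := fun g => σ * g * σ⁻¹) (by fun_prop)
    exact this
  · rw [hmem, happ, h.mem_iff]
  · obtain ⟨g', hg'⟩ := h.exists_conjTranspose (σ⁻¹ * g * σ)
    refine ⟨σ * g' * σ⁻¹, ?_⟩
    rw [happ, happ, ← hg']
    congr 2; group
  · rw [happ] at hg
    obtain ⟨φ, X, hφ, hφY⟩ := h.exists_isOneParam Y hY _ hg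
    obtain ⟨X', hX'⟩ := hφ.conj σ
    refine ⟨_, X', hX', fun z => ?_⟩
    rw [happ, ← hφY]
    congr 2; group
  · rw [hrange]; exact h.isClosed_pos
  · have h1 : σ⁻¹ * x * σ ∈ Subgroup.center G := h.central _ fun k hk => by
      have := hx (σ * k * σ⁻¹) ((hmem _).2 (by simpa [mul_assoc] using hk))
      calc k * (σ⁻¹ * x * σ) = σ⁻¹ * (σ * k * σ⁻¹ * x) * σ := by group
        _ = σ⁻¹ * (x * (σ * k * σ⁻¹)) * σ := by rw [this]
        _ = _ := by group
    have h2 : σ * (σ⁻¹ * x * σ) = σ⁻¹ * x * σ * σ := Subgroup.mem_center_iff.1 h1 σ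
    have h3 : x = σ⁻¹ * x * σ := by
      calc x = σ * (σ⁻¹ * x * σ) * σ⁻¹ := by group
        _ = _ := by rw [h2]; group
    rw [h3]; exact h1

/-- Cartan's fixed point theorem: every compact subgroup is conjugate to a subgroup of `K`. -/
theorem exists_conj_mem (h : IsPolarRep E ρ K) {L : Subgroup G} (hL : IsCompact (L : Set G)) :
    ∃ σ : G, ∀ l ∈ L, σ⁻¹ * l * σ ∈ K := by
  have : IsTopologicalGroup G := topologicalGroup_of_lieGroup 𝓘(ℂ, E) ω
  have : CompactSpace L := isCompact_iff_compactSpace.1 hL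
  obtain ⟨q, hq, hqL⟩ := exists_posDef_invariant (ρ.comp L.subtype)
    (h.holomorphic.continuous.comp continuous_subtype_val)
  obtain ⟨b, hb, rfl⟩ := hq.exists_isHermitian_mul_self
  obtain ⟨p₀, ⟨⟨g₀, rfl⟩, hp₀⟩, hmin⟩ := exists_isMinOn_traceEnergy hb h.isClosed_pos
    (fun p hp => hp.2) (p₁ := 1) ⟨one_mem _, PosSemidef.one⟩
  obtain ⟨s, hs, rfl⟩ := h.exists_sqrt hp₀
  have hsH := hs.isHermitian
  refine ⟨s, fun l hl => (h.mem_iff _).2 ?_⟩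
  obtain ⟨l', hl'⟩ := h.exists_conjTranspose l
  have hE : traceEnergy b (ρ (l * (s * s) * l')) = traceEnergy b (ρ (s * s)) := by
    rw [map_mul, map_mul]
    refine traceEnergy_congruence ?_
    rw [hl']; exact hqL ⟨l, hl⟩
  have hm : (ρ (s⁻¹ * (l * (s * s) * l') * s⁻¹) : Mat).PosSemidef := by
    have h1 : (ρ (s⁻¹ * (l * (s * s) * l') * s⁻¹) : Mat) =
        (ρ (s⁻¹ * l * s) : Mat) * (ρ (s⁻¹ * l * s) : Mat)ᴴ := by
      have h2 : s⁻¹ * (l * (s * s) * l') * s⁻¹ = (s⁻¹ * l * s) * (s * l' * s⁻¹) := by group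
      rw [h2, map_mul _ (s⁻¹ * l * s), Units.val_mul]
      congr 1
      simp only [map_mul, Units.val_mul, conjTranspose_mul, hsH.eq, hl', _root_.map_inv,
        hsH.units_inv.eq, mul_assoc]
    rw [h1]; exact posSemidef_self_mul_conjTranspose _
  -- With this `w`, the geodesic from the minimizer `s²` to its translate `l s² lᴴ = s w² s` has
  -- midpoint `s w s`, which is again in the positive part. The ends have equal, minimal energy, so
  -- strict convexity forces `w = 1`.
  obtain ⟨w, hw, hww⟩ := h.exists_sqrt hm
  have hwH := hw.isHermitian
  have hsws : s * (w * w) * s = l * (s * s) * l' := by rw [hww]; group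
  have hmid : (ρ (s * w * s) : Mat).PosSemidef := by
    have := hw.conjTranspose_mul_mul_same (ρ s : Mat)
    rwa [hsH.eq, ← Units.val_mul, ← Units.val_mul, ← map_mul, ← map_mul] at this
  have hw1 : ρ w = 1 := by
    refine eq_one_of_traceEnergy_le hb hsH hwH ?_
    have h1 := hmin _ ⟨⟨s * w * s, rfl⟩, hmid⟩
    have h2 := hE
    rw [← hsws] at h2
    simp only [map_mul] at h1 h2 ⊢
    linarith
  have hw1' : w = 1 := h.injective (by rw [hw1, map_one])
  rw [hw1', one_mul, mul_one] at hsws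
  rw [mem_unitaryGroup_iff, star_eq_conjTranspose]
  have h3 : (ρ (s⁻¹ * l * s) : Mat)ᴴ = (ρ (s * l' * s⁻¹) : Mat) := by
    simp only [map_mul, Units.val_mul, conjTranspose_mul, hsH.eq, hl', _root_.map_inv,
        hsH.units_inv.eq, mul_assoc]
  rw [h3, ← Units.val_mul, ← map_mul]
  have h4 : s⁻¹ * l * s * (s * l' * s⁻¹) = 1 := by
    calc _ = s⁻¹ * (l * (s * s) * l') * s⁻¹ := by group
      _ = 1 := by rw [← hsws]; group
  rw [h4]; simp

end IsPolarRep

end Reductive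

/-! ### Conjugacy of maximal compact subgroups, normalizers and common maximal tori -/

section MaximalCompact

open scoped Matrix.Norms.L2Operator
open NormedSpace Matrix Topology ComplexLie

variable {E : Type*} [NormedAddCommGroup E] [NormedSpace ℂ E]
  {G : Type*} [TopologicalSpace G] [ChartedSpace E G] [Group G] [LieGroup 𝓘(ℂ, E) ω G] {n : ℕ}
  {ρ : G →* GL (Fin n) ℂ} {K : Subgroup G}

namespace IsPolarRep

theorem isMaximalCompact_eq_map (h : IsPolarRep E ρ K) {K' : Subgroup G}
    (hK' : IsMaximalCompact K') : ∃ σ : G, K' = K.map (MulAut.conj σ).toMonoidHom := by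
  have : IsTopologicalGroup G := topologicalGroup_of_lieGroup 𝓘(ℂ, E) ω
  obtain ⟨σ, hσ⟩ := h.exists_conj_mem hK'.1
  have hle : K' ≤ K.map (MulAut.conj σ).toMonoidHom := fun k hk =>
    ⟨_, hσ k hk, by simp [mul_assoc]⟩
  exact ⟨σ, le_antisymm hle (hK'.2 (h.conj σ).isCompact hle)⟩

/-- The unitary factor of a normalizing element normalizes `K`, hence so does the positive factor;
rigidity makes its whole one-parameter group commute with `K`. That group is therefore central and
joins the positive factor to `1`. -/
theorem normalizer_subset (h : IsPolarRep E ρ K) :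
    (Subgroup.normalizer (K : Set G) : Set G) ⊆ centerIdentityComponent G * (K : Set G) := by
  intro g hg
  obtain ⟨k, hk, Y, φ, X, hY, hφ, hφY, rfl⟩ := h.exists_polar g
  have hcomm : ∀ z, φ z ∈ Subgroup.center G := fun z => h.central _ fun x hx => by
    refine h.commute_of_conj_mem hY hφY hx ?_ z
    have h1 := (Subgroup.mem_normalizer_iff.1 hg x).1 hx
    have h2 : φ 1 * x * φ (-1) = k⁻¹ * (k * φ 1 * x * (k * φ 1)⁻¹) * k := by
      rw [hφ.map_neg]; group
    rw [h2]
    exact mul_mem (mul_mem (inv_mem hk) h1) hk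
  refine ⟨φ 1, ?_, k, hk, ((Subgroup.mem_center_iff.1 (hcomm 1)) k).symm⟩
  have hpre : IsPreconnected (Set.range φ) :=
    isPreconnected_range hφ.holomorphic.continuous
  exact hpre.subset_connectedComponentIn ⟨0, hφ.map_zero⟩
    (by rintro _ ⟨z, rfl⟩; exact hcomm z) ⟨1, rfl⟩

/-- A one-parameter group of `K` that commutes with a maximal torus lies in it. -/
theorem mem_of_commute_maximalTorus (h : IsPolarRep E ρ K) {T : Subgroup G}
    (hT : IsMaximalCompactTorus T) (hTK : T ≤ K) {ψ : ℝ → G} (hψ : Continuous ψ)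
    (hadd : ∀ s t, ψ (s + t) = ψ s * ψ t) (hψK : ∀ t, ψ t ∈ K)
    (hcomm : ∀ x ∈ T, ∀ t, x * ψ t = ψ t * x) (t : ℝ) : ψ t ∈ T := by
  have : IsTopologicalGroup G := topologicalGroup_of_lieGroup 𝓘(ℂ, E) ω
  have : T2Space G := T2Space.of_injective_continuous
    (f := fun g => (ρ g : Matrix (Fin n) (Fin n) ℂ))
    (fun g g' hg => h.injective (Units.ext hg)) h.holomorphic.continuous
  have h0 : ψ 0 = 1 := by
    have := hadd 0 0
    rwa [add_zero, left_eq_mul] at this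
  -- `S = T ψ(ℝ)` is connected and abelian; its closure stays in the compact group `K`, so it is a
  -- compact torus containing `T` and equals `T` by maximality.
  let S : Subgroup G :=
    { carrier := Set.range fun p : T × ℝ => (p.1 : G) * ψ p.2
      one_mem' := ⟨(1, 0), by simp [h0]⟩
      mul_mem' := by
        rintro _ _ ⟨⟨x, s⟩, rfl⟩ ⟨⟨y, t⟩, rfl⟩
        refine ⟨(x * y, s + t), ?_⟩
        simp only [Subgroup.coe_mul, hadd]
        rw [mul_assoc, mul_assoc, ← mul_assoc (y : G), hcomm y y.2 s, mul_assoc]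
      inv_mem' := by
        rintro _ ⟨⟨x, s⟩, rfl⟩
        refine ⟨(x⁻¹, -s), ?_⟩
        have h1 : ψ (-s) = (ψ s)⁻¹ := by
          rw [eq_inv_iff_mul_eq_one, ← hadd, neg_add_cancel, h0]
        simp only [Subgroup.coe_inv, h1]
        rw [hcomm x x.2 s, _root_.mul_inv_rev] }
  have hTS : T ≤ S := fun x hx => ⟨(⟨x, hx⟩, 0), by simp [h0]⟩
  have hSK : S ≤ K := by
    rintro _ ⟨⟨x, s⟩, rfl⟩
    exact mul_mem (hTK x.2) (hψK s)
  have hSconn : IsConnected (S : Set G) := by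
    have : ConnectedSpace T := isConnected_iff_connectedSpace.1 hT.1.connected
    exact isConnected_range ((continuous_subtype_val.comp continuous_fst).mul
      (hψ.comp continuous_snd))
  have hScomm : (S : Set G) ⊆ Set.centralizer (S : Set G) := by
    rintro _ ⟨⟨x, s⟩, rfl⟩ _ ⟨⟨y, t⟩, rfl⟩
    have h1 : ψ t * ψ s = ψ s * ψ t := by rw [← hadd, ← hadd, add_comm]
    have h2 := hT.1.comm x x.2 y y.2
    simp only
    calc (y : G) * ψ t * (x * ψ s) = y * (ψ t * x) * ψ s := by group
      _ = (y * x) * (ψ t * ψ s) := by rw [← hcomm x x.2]; group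
      _ = x * (y * ψ s) * ψ t := by rw [h1, ← h2]; group
      _ = _ := by rw [hcomm y y.2]; group
  have hcl : closure (S : Set G) ⊆ Set.centralizer (closure (S : Set G)) := by
    have h1 : closure (S : Set G) ⊆ Set.centralizer (S : Set G) :=
      closure_minimal hScomm (Set.isClosed_centralizer _)
    refine closure_minimal (fun x hx y hy => ?_) (Set.isClosed_centralizer _)
    exact (h1 hy x hx).symm
  have htorus : IsCompactTorus S.topologicalClosure :=
    { compact := h.isCompact.of_isClosed_subset S.isClosed_topologicalClosure
        (S.topologicalClosure_minimal hSK h.isCompact.isClosed)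
      connected := by
        rw [Subgroup.topologicalClosure_coe]; exact hSconn.closure
      comm := fun x hx y hy => hcl hy x hx }
  exact hT.2 htorus (hTS.trans S.le_topologicalClosure)
    (S.le_topologicalClosure ⟨(1, t), by simp⟩)

/-- Only the positive factor of the conjugating element matters, as the unitary one normalizes `K₁`.
Rigidity makes it commute with `K`, and maximality of `T` puts its imaginary-time group inside `K`.
-/
theorem exists_conj_of_common_maximalTorus [FiniteDimensional ℂ E] {K₁ K₂ K T : Subgroup G}
    (h : IsPolarRep E ρ K₁) (hK₂ : IsMaximalCompact K₂) (h₁ : K ≤ K₁) (h₂ : K ≤ K₂)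
    (hT : IsMaximalCompactTorus T) (hTK : T ≤ K) :
    ∃ t ∈ complexification E K, (∀ x ∈ complexification E K, t * x = x * t) ∧
      K₂ = K₁.map (MulAut.conj t).toMonoidHom := by
  obtain ⟨σ, hσ⟩ := h.isMaximalCompact_eq_map hK₂
  obtain ⟨k, hk, Y, φ, X, hY, hφ, hφY, hσk⟩ := h.exists_polar σ⁻¹
  have hσ' : σ = φ (-1) * k⁻¹ := by
    rw [hφ.map_neg, ← _root_.mul_inv_rev, ← hσk, inv_inv]
  have hmem : ∀ g, g ∈ K₂ ↔ φ 1 * g * φ (-1) ∈ K₁ := fun g => by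
    rw [hσ, hσ', Subgroup.mem_map_equiv]
    have : (MulAut.conj (φ (-1) * k⁻¹)).symm g = k * (φ 1 * g * φ (-1)) * k⁻¹ := by
      rw [MulAut.conj_symm_apply, hφ.map_neg]; group
    rw [this]
    constructor
    · intro hg
      have := mul_mem (mul_mem (inv_mem hk) hg) hk
      simpa [mul_assoc] using this
    · intro hg
      exact mul_mem (mul_mem hk hg) (inv_mem hk)
  have hcomm : ∀ x ∈ K, ∀ z, x * φ z = φ z * x := fun x hx z =>
    h.commute_of_conj_mem hY hφY (h₁ hx) ((hmem x).1 (h₂ hx)) z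
  have hφK : ∀ t : ℝ, φ (Complex.I * t) ∈ K₁ := fun t => by
    rw [h.mem_iff, hφY, mul_comm]
    exact exp_smul_I_mem_unitaryGroup hY t
  have hφT : ∀ t : ℝ, φ (Complex.I * t) ∈ T :=
    h.mem_of_commute_maximalTorus hT (hTK.trans h₁) (ψ := fun t : ℝ => φ (Complex.I * t))
      (hφ.holomorphic.continuous.comp (continuous_const.mul Complex.continuous_ofReal))
      (fun s t => by push_cast; rw [mul_add, hφ.map_add]) hφK
      fun x hx t => hcomm x (hTK hx) _
  obtain ⟨X', hX'⟩ := hφ.comp_mul Complex.I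
  -- The one-parameter group `z ↦ φ (i z)` lies in `K` at real times, and its value at `z = i` is `φ
  -- (-1)`.
  refine ⟨φ (-1), Subgroup.subset_closure (Or.inr ⟨_, X', Complex.I, hX',
    fun t => hTK (hφT t), by rw [Complex.I_mul_I]⟩), fun x hx => ?_, ?_⟩
  · exact (commute_complexification h.injective h.holomorphic (fun y hy => hcomm y hy (-1)) hx).symm
  · ext g
    rw [hmem, Subgroup.mem_map_equiv, MulAut.conj_symm_apply, hφ.map_neg, inv_inv]

end IsPolarRep

theorem ComplexLie.IsReductive.exists_isPolarRep_of_isMaximalCompact [FiniteDimensional ℂ E]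
    [ConnectedSpace G] (hG : IsReductive E G) (hK : IsMaximalCompact K) :
    ∃ (n : ℕ) (ρ : G →* GL (Fin n) ℂ), IsPolarRep E ρ K := by
  obtain ⟨n, ρ, U, h⟩ := hG.exists_isPolarRep
  obtain ⟨σ, rfl⟩ := h.isMaximalCompact_eq_map hK
  exact ⟨n, _, h.conj σ⟩

end MaximalCompact

theorem mainTheorem9
    {E : Type*} [NormedAddCommGroup E] [NormedSpace ℂ E] [FiniteDimensional ℂ E]
    {G : Type*} [TopologicalSpace G] [ChartedSpace E G] [Group G]
    [LieGroup 𝓘(ℂ, E) ω G] [ConnectedSpace G]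
    (hG : ComplexLie.IsReductive E G) :
    (∀ K : Subgroup G, IsMaximalCompact K →
      (Subgroup.normalizer (K : Set G) : Set G) = (Subgroup.center G : Set G) * (K : Set G) ∧
      (Subgroup.normalizer (K : Set G) : Set G) = centerIdentityComponent G * (K : Set G)) ∧
    (∀ K₁ K₂ K T : Subgroup G, IsMaximalCompact K₁ → IsMaximalCompact K₂ →
      IsCompact (K : Set G) → K ≤ K₁ → K ≤ K₂ →
      IsMaximalCompactTorus T → T ≤ K →
      ∃ t ∈ ComplexLie.complexification E K,
        (∀ x ∈ ComplexLie.complexification E K, t * x = x * t) ∧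
        K₂ = K₁.map (MulAut.conj t).toMonoidHom) := by
  refine ⟨fun K hK => ?_, fun K₁ K₂ K T hK₁ hK₂ _ h₁ h₂ hT hTK => ?_⟩
  · obtain ⟨n, ρ, h⟩ := hG.exists_isPolarRep_of_isMaximalCompact hK
    have hsub : centerIdentityComponent G * (K : Set G) ⊆
        (Subgroup.center G : Set G) * (K : Set G) :=
      Set.mul_subset_mul_right (connectedComponentIn_subset _ _)
    have hN : (Subgroup.center G : Set G) * (K : Set G) ⊆
        (Subgroup.normalizer (K : Set G) : Set G) := by
      rintro _ ⟨c, hc, k, hk, rfl⟩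
      exact mul_mem (Subgroup.center_le_normalizer _ hc) (Subgroup.le_normalizer hk)
    exact ⟨(h.normalizer_subset.trans hsub).antisymm hN,
      h.normalizer_subset.antisymm (hsub.trans hN)⟩
  · obtain ⟨n, ρ, h⟩ := hG.exists_isPolarRep_of_isMaximalCompact hK₁
    exact h.exists_conj_of_common_maximalTorus hK₂ h₁ h₂ hT hTK
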